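/- Let $G$ be a finite or countably infinite group, let $\mathcal A=\{a_1,a_2,\dots\}$ be a finite or countably infinite alphabet of generators of $G$ (each letter $a_i$ represents an element of $G$, and these elements generate $G$), and let $\mathcal X$ be a finite or countably infinite set of variables. An equation over $G$ is an expression $W=1$, where $W$ is a nonempty cyclically reduced word over $\mathcal A^{\pm1}\cup\mathcal X^{\pm1}$ that contains at least one letter of $\mathcal X^{\pm1}$; its length $|W|_{\mathcal X}$ is the number of occurrences of letters of $\mathcal X^{\pm1}$ in $W$. The equation is quadratic if, for every $x\in\mathcal X$, the total number of occurrences of $x$ and $x^{-1}$ in $W$ is $2$ or $0$. It has a solution in $G$ if there is a homomorphism $\psi: G*F(\mathcal X)\to G$ that is the identity on $G$ and satisfies $\psi(W)=1$. For a monomorphism $\mu: G\to H$, the equation $\mu(W)=1$ over $H$ is obtained from $W=1$ by replacing every letter $a_i^{\pm1}$ with the element $\mu(a_i)^{\pm1}$ of $H$; it has a solution in $H$ if some homomorphism $H*F(\mathcal X)\to H$ is the identity on $H$ and takes $\mu(W)$ to $1$. Theorem. Let $n\ge 2$ be an integer and let $G$ be a finite or countably infinite group. Then there is an embedding $\mu_n: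 G\to H$ of $G$ into a $2$-generated group $H=\langle h_1,h_2\rangle$, depending only on $n$ and $G$, such that for every choice of $\mathcal A$ and $\mathcal X$ as above and every quadratic equation $W=1$ over $G$ of length $|W|_{\mathcal X}\le n$, the equation $W=1$ has a solution in $G$ if and only if the equation $\mu_n(W)=1$ has a solution in $H$. -/

import Mathlib

universe u v w

namespace QuadEq

/-- Words over the alphabet `𝒴^{±1}` with `𝒴 = 𝒜 ⊔ 𝒳`, where `𝒜` is an alphabet of constants and `𝒳`
an alphabet of variables. The letter `(y, true)` is `y` and `(y, false)` is `y⁻¹`. -/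
abbrev Word (A : Type*) (X : Type*) := List ((A ⊕ X) × Bool)

/-- The `𝒳`-length of a word: the number of occurrences of letters of `𝒳^{±1}`. -/
def xLength {A X : Type*} (W : Word A X) : ℕ :=
  W.countP (fun y => y.1.isRight)

open Classical in
/-- The number of occurrences of `x` plus the number of occurrences of `x⁻¹` in a word. -/
noncomputable def occurrences {A X : Type*} (x : X) (W : Word A X) : ℕ :=
  W.countP (fun y => decide (y = (Sum.inr x, true))) +
    W.countP (fun y => decide (y = (Sum.inr x, false)))

/-- `W = 1` is an equation: `W` is a cyclically reduced word with `|W|_𝒳 > 0`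
(in particular `W` is not empty). -/
structure IsEquation {A X : Type*} (W : Word A X) : Prop where
  cyclicallyReduced : FreeGroup.IsCyclicallyReduced W
  xLength_pos : 0 < xLength W

/-- `W = 1` is a quadratic equation. -/
structure IsQuadraticEquation {A X : Type*} (W : Word A X) : Prop extends IsEquation W where
  occurrences_eq : ∀ x : X, occurrences x W = 2 ∨ occurrences x W = 0

/-- The element of the free product `K * F(𝒳)` obtained from the word `W` by replacing every
letter `a^{±1}`, `a ∈ 𝒜`, with the element `(c a)^{±1}` of `K`. -/
def toFreeProduct {A X K : Type*} [Group K] (c : A → K) (W : Word A X) :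
    Monoid.Coprod K (FreeGroup X) :=
  FreeGroup.lift
    (Sum.elim (fun a => Monoid.Coprod.inl (c a)) (fun x => Monoid.Coprod.inr (FreeGroup.of x)))
    (FreeGroup.mk W)

/-- The equation `w = 1`, `w ∈ K * F(𝒳)`, has a solution in `K`: some homomorphism
`K * F(𝒳) → K` is the identity on `K` and takes `w` to `1`. -/
def HasSolution {X K : Type*} [Group K] (w : Monoid.Coprod K (FreeGroup X)) : Prop :=
  ∃ ψ : Monoid.Coprod K (FreeGroup X) →* K,
    ψ.comp Monoid.Coprod.inl = MonoidHom.id K ∧ ψ w = 1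

end QuadEq

/-! A solution over `G` is carried to one over `H` by `μ`, so only the converse needs work. Let E be
free on c, y_0, y_1, ... (`BaseFree`) and L = ℤ * ℤ (`TwoFree`), with stable letter t. Embed E in L
by c ↦ t and y_j ↦ g_0 t g_1 ⋯ t g_{N+2}, where the g_i are cyclic syllables `gap j i`, distinct for
distinct pairs (j, i). For 2 ≤ k ≤ N + 1 let ρ_k : L → E read a normal form: a t between `gap j (k -
1)` and `gap j k` contributes y_j corrected by powers of c, any other t contributes c, and t⁻¹
contributes the inverse label. Then ρ_k is a left inverse of the embedding. It is not a
homomorphism, but a given product is respected for all but a bounded number of k, because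
multiplication changes labels only near the place where cancellation stops. Hence, if N is large,
some ρ_k carries a solution in L of an equation over E with few occurrences of variables to a
solution in E (`equationallyClosed_embed`).

The group K = G × Perm(E × Bool) contains another copy of E (`hostHom_injective`), arranged so that
c is the square of an element s, and y_{2i+1} is the s-conjugate of y_{2i} times the i-th element of
`G`. In the amalgam of K and L over E, the element s and the generator of the cyclic factor of L
yield c, then every y_j, then every element of `G`. These two elements generate `H`.

It remains to pull a solution of a quadratic equation back from the amalgam to K
(`IsAmalgam.exists_solution`) and project to `G`. Write the values of the variables in normal form
and turn each syllable from L into a new variable, which again occurs twice. By the normal form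
theorem the trivial product breaks up into a system of equations over E that hold in L
(`IsAmalgam.exists_split`). The system may be arbitrarily large, but the number of occurrences of
variables minus twice the number of words is bounded in terms of `n`, like an Euler characteristic.
Eliminating a variable shared by two words preserves this difference; words that share no variables
have bounded length, and are solved in E by equational closure (`exists_solution_of_system`). -/

namespace QuadEq

/-! ### Almost retractions of a free product of two infinite cyclic groups -/

/-- The infinite cyclic group. -/
abbrev Cyc := Multiplicative ℤ

/-- The free product of `Cyc` and an infinite cyclic group generated by the stable letter. -/
abbrev TwoFree := HNNExtension Cyc ⊥ ⊥ (MulEquiv.refl _)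

/-- The free group of countable rank, with a distinguished basis element. -/
abbrev BaseFree := FreeGroup (Option ℕ)

namespace TwoFree

open HNNExtension

/-- The distinguished basis element. -/
def c : BaseFree := FreeGroup.of none

/-- The other basis elements. -/
def y (j : ℕ) : BaseFree := FreeGroup.of (some j)

/-- An injective family of elements with positive exponents. -/
def gap (j k : ℕ) : Cyc := Multiplicative.ofAdd ((Nat.pair j k : ℤ) + 1)

theorem gap_inj {j k j' k' : ℕ} : gap j k = gap j' k' ↔ j = j' ∧ k = k' := by
  rw [gap, gap, Multiplicative.ofAdd.injective.eq_iff]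
  rw [add_left_inj, Nat.cast_inj, Nat.pair_eq_pair]

theorem gap_ne_one (j k : ℕ) : gap j k ≠ 1 := by
  rw [gap, ← ofAdd_zero, Multiplicative.ofAdd.injective.ne_iff]
  positivity

theorem one_ne_gap (j k : ℕ) : 1 ≠ gap j k := (gap_ne_one j k).symm

theorem gap_inv_ne_gap (j k j' k' : ℕ) : (gap j k)⁻¹ ≠ gap j' k' := by
  rw [gap, gap, ← ofAdd_neg, Multiplicative.ofAdd.injective.ne_iff]
  have : (0 : ℤ) ≤ Nat.pair j k := by positivity
  have : (0 : ℤ) ≤ Nat.pair j' k' := by positivity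
  omega

section Label

variable (N : ℕ)

/-- The label of the stable letter in a pattern of the `k`th kind. -/
def mark (j k : ℕ) : BaseFree := (c ^ (k - 1))⁻¹ * y j * (c ^ (N + 2 - k))⁻¹

open Classical in
/-- The label of an occurrence of the stable letter preceded by `p` and followed by `q`. -/
noncomputable def labelPos (k : ℕ) (p q : Cyc) : BaseFree :=
  if h : ∃ j, p = gap j (k - 1) ∧ q = gap j k then mark N h.choose k else c

/-- The label of an occurrence of the stable letter with sign `ε`, preceded by `p` and followed
by `q`. -/
noncomputable def label (k : ℕ) (p : Cyc) (ε : ℤˣ) (q : Cyc) : BaseFree :=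
  if ε = 1 then labelPos N k p q else (labelPos N k q⁻¹ p⁻¹)⁻¹

theorem labelPos_gap (j k : ℕ) : labelPos N k (gap j (k - 1)) (gap j k) = mark N j k := by
  have h : ∃ j', gap j (k - 1) = gap j' (k - 1) ∧ gap j k = gap j' k := ⟨j, rfl, rfl⟩
  rw [labelPos, dif_pos h]
  rw [← (gap_inj.1 h.choose_spec.2).1]

theorem labelPos_of_ne {k : ℕ} {p q : Cyc} (h : ∀ j, p = gap j (k - 1) → q ≠ gap j k) :
    labelPos N k p q = c := by
  rw [labelPos, dif_neg]
  rintro ⟨j, h1, h2⟩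
  exact h j h1 h2

theorem label_inv (k : ℕ) (p : Cyc) (ε : ℤˣ) (q : Cyc) :
    label N k q⁻¹ (-ε) p⁻¹ = (label N k p ε q)⁻¹ := by
  rcases Int.units_eq_one_or ε with rfl | rfl <;> simp [label]

/-- A given occurrence of the stable letter has a special label for at most one `k`. -/
theorem exists_label_generic (p : Cyc) (ε : ℤˣ) (q : Cyc) :
    ∃ κ : ℕ, ∀ k ≠ κ, label N k p ε q = c ^ (ε : ℤ) := by
  have key : ∀ q : Cyc, ∃ κ : ℕ, ∀ k ≠ κ, ∀ p, labelPos N k p q = c := by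
    intro q
    by_cases h : ∃ j k, q = gap j k
    · obtain ⟨j, k, rfl⟩ := h
      refine ⟨k, fun k' hk p => labelPos_of_ne N fun j' _ h2 => hk ?_⟩
      exact (gap_inj.1 h2).2.symm
    · push Not at h
      exact ⟨0, fun k _ p => labelPos_of_ne N fun j _ => h j k⟩
  rcases Int.units_eq_one_or ε with rfl | rfl
  · obtain ⟨κ, hκ⟩ := key q
    exact ⟨κ, fun k hk => by simp [label, hκ k hk]⟩
  · obtain ⟨κ, hκ⟩ := key p⁻¹
    exact ⟨κ, fun k hk => by simp [label, hκ k hk]⟩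

/-- The product of the labels of the stable letters in a word. -/
noncomputable def labelProd (k : ℕ) : Cyc → List (ℤˣ × Cyc) → BaseFree
  | _, [] => 1
  | p, (ε, q) :: t => label N k p ε q * labelProd k q t

/-- The value of a word. -/
noncomputable def val (p : Cyc) (t : List (ℤˣ × Cyc)) : TwoFree :=
  of p * (t.map fun x => HNNExtension.t ^ (x.1 : ℤ) * of x.2).prod

/-- Reducedness of a word. -/
def Red (t : List (ℤˣ × Cyc)) : Prop := t.IsChain fun a b => a.2 = 1 → a.1 = b.1

theorem val_nil (p : Cyc) : val p [] = of p := by simp [val]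

theorem val_cons (p : Cyc) (ε : ℤˣ) (q : Cyc) (t : List (ℤˣ × Cyc)) :
    val p ((ε, q) :: t) = of p * HNNExtension.t ^ (ε : ℤ) * val q t := by
  simp [val, mul_assoc]

theorem of_mul_val (p q : Cyc) (t : List (ℤˣ × Cyc)) : of p * val q t = val (p * q) t := by
  simp [val, mul_assoc]

/-- The word for the quotient of the values of two words. -/
def glue : Cyc → List (ℤˣ × Cyc) → Cyc → List (ℤˣ × Cyc) → Cyc × List (ℤˣ × Cyc)
  | p, [], q, s => (p⁻¹ * q, s)
  | p, (ε, p') :: t, q, s => glue p' t 1 ((-ε, p⁻¹ * q) :: s)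

theorem val_glue (t : List (ℤˣ × Cyc)) : ∀ (p q : Cyc) (s : List (ℤˣ × Cyc)),
    val (glue p t q s).1 (glue p t q s).2 = (val p t)⁻¹ * val q s := by
  induction t with
  | nil => intro p q s; simp [glue, val_nil, ← of_mul_val]
  | cons x t ih =>
    obtain ⟨ε, p'⟩ := x
    intro p q s
    rw [glue, ih, val_cons, val_cons, ← of_mul_val]
    simp [mul_assoc]

/-- The only new syllable is `p⁻¹ * q`. It is trivial only if `p = q`, and the last hypothesis then
excludes a cancelling pair of stable letters around it. -/
theorem red_glue (t : List (ℤˣ × Cyc)) : ∀ (p q : Cyc) (s : List (ℤˣ × Cyc)), Red t → Red s →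
    (∀ a ∈ t.head?, ∀ b ∈ s.head?, p = q → a.1 ≠ b.1) → Red (glue p t q s).2 := by
  induction t with
  | nil => intro p q s _ hs _; exact hs
  | cons x t ih =>
    obtain ⟨ε, p'⟩ := x
    intro p q s ht hs h
    rw [glue]
    refine ih _ _ _ ht.tail ?_ ?_
    · refine List.isChain_cons.2 ⟨fun b hb hpq => ?_, hs⟩
      have := h (ε, p') (by simp) b hb (by simpa [inv_mul_eq_one] using hpq)
      simp only at this ⊢
      rcases Int.units_eq_one_or ε with rfl | rfl <;>
        rcases Int.units_eq_one_or b.1 with h' | h' <;> simp_all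
    · intro a ha b hb hp
      simp only [List.head?_cons, Option.mem_def, Option.some.injEq] at hb
      subst hb
      have := (List.isChain_cons.1 ht).1 a ha hp
      simp only at this ⊢
      rw [← this]
      rcases Int.units_eq_one_or ε with rfl | rfl <;> simp

theorem labelProd_glue_one (k : ℕ) (t : List (ℤˣ × Cyc)) : ∀ (p : Cyc) (δ : ℤˣ) (r : Cyc)
    (s : List (ℤˣ × Cyc)),
    labelProd N k (glue p t 1 ((δ, r) :: s)).1 (glue p t 1 ((δ, r) :: s)).2 =
      (labelProd N k p t)⁻¹ * label N k p⁻¹ δ r * labelProd N k r s := by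
  induction t with
  | nil => intro p δ r s; simp [glue, labelProd]
  | cons x t ih =>
    obtain ⟨ε, p'⟩ := x
    intro p δ r s
    rw [glue, ih, mul_one, label_inv]
    simp [labelProd, mul_assoc]

/-- Only the label of the first stable letter sees the initial syllable. -/
theorem exists_labelProd_head (p p' : Cyc) (t : List (ℤˣ × Cyc)) :
    ∃ S : Finset ℕ, S.card ≤ 2 ∧ ∀ k ∉ S, labelProd N k p t = labelProd N k p' t := by
  rcases t with _ | ⟨⟨ε, q⟩, t⟩
  · exact ⟨∅, by simp, fun k _ => rfl⟩
  · obtain ⟨κ, h⟩ := exists_label_generic N p ε q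
    obtain ⟨κ', h'⟩ := exists_label_generic N p' ε q
    refine ⟨{κ, κ'}, Finset.card_le_two, fun k hk => ?_⟩
    simp only [Finset.mem_insert, Finset.mem_singleton, not_or] at hk
    simp [labelProd, h k hk.1, h' k hk.2]

/-- Only the two stable letters next to the junction see a changed neighbour. For each of them two
values of `k` are discarded, one for the old and one for the new neighbour. -/
theorem exists_labelProd_glue (p q : Cyc) (t s : List (ℤˣ × Cyc)) :
    ∃ S : Finset ℕ, S.card ≤ 4 ∧ ∀ k ∉ S,
      labelProd N k (glue p t q s).1 (glue p t q s).2 =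
        (labelProd N k p t)⁻¹ * labelProd N k q s := by
  obtain ⟨S, hS, h⟩ := exists_labelProd_head N (p⁻¹ * q) q s
  rcases t with _ | ⟨⟨ε, p'⟩, t⟩
  · exact ⟨S, by omega, fun k hk => by simp [glue, labelProd, h k hk]⟩
  · obtain ⟨κ, h1⟩ := exists_label_generic N p'⁻¹ (-ε) (p⁻¹ * q)
    obtain ⟨κ', h2⟩ := exists_label_generic N p'⁻¹ (-ε) p⁻¹
    refine ⟨{κ, κ'} ∪ S, ?_, fun k hk => ?_⟩
    · have := Finset.card_union_le {κ, κ'} S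
      have : ({κ, κ'} : Finset ℕ).card ≤ 2 := Finset.card_le_two
      omega
    · simp only [Finset.mem_union, Finset.mem_insert, Finset.mem_singleton, not_or] at hk
      rw [glue, labelProd_glue_one, h k hk.2, h1 k hk.1.1, ← h2 k hk.1.2, label_inv]
      simp [labelProd, mul_assoc]

/-- The quotient of two reduced words is represented by a reduced word, and labelling is compatible
with this for all but at most six of the `k`. -/
theorem exists_div (t : List (ℤˣ × Cyc)) : ∀ (p q : Cyc) (s : List (ℤˣ × Cyc)),
    Red t → Red s → ∃ r x, Red x ∧ val r x = (val p t)⁻¹ * val q s ∧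
      ∃ S : Finset ℕ, S.card ≤ 6 ∧ ∀ k ∉ S,
        labelProd N k r x = (labelProd N k p t)⁻¹ * labelProd N k q s := by
  induction t with
  | nil =>
    intro p q s _ hs
    obtain ⟨S, hS, h⟩ := exists_labelProd_glue N p q [] s
    exact ⟨_, _, red_glue [] p q s List.isChain_nil hs (by simp), val_glue _ _ _ _, S, by omega, h⟩
  | cons x t ih =>
    obtain ⟨ε, p'⟩ := x
    intro p q s ht hs
    -- A common first syllable and stable letter cancel. While the next syllables also agree, the
    -- cancelled labels are equal and nothing is lost; the `k` are discarded only where cancellation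
    -- stops.
    by_cases hc : ∃ q' s', s = (ε, q') :: s' ∧ p = q
    · obtain ⟨q', s', rfl, rfl⟩ := hc
      have hval : (val p ((ε, p') :: t))⁻¹ * val p ((ε, q') :: s') = (val p' t)⁻¹ * val q' s' := by
        simp only [val_cons]; group
      rw [hval]
      by_cases hpq : p' = q'
      · subst hpq
        obtain ⟨r, x, hx, hv, S, hS, h⟩ := ih p' p' s' ht.tail hs.tail
        refine ⟨r, x, hx, hv, S, hS, fun k hk => ?_⟩
        rw [h k hk]
        simp only [labelProd]; group
      · obtain ⟨S, hS, h⟩ := exists_labelProd_glue N p' q' t s'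
        -- The last cancelled pair of stable letters has different right neighbours, so its labels
        -- may differ for two further values of `k`.
        obtain ⟨κ, h1⟩ := exists_label_generic N p ε p'
        obtain ⟨κ', h2⟩ := exists_label_generic N p ε q'
        refine ⟨_, _, red_glue t p' q' s' ht.tail hs.tail (fun _ _ _ _ h => absurd h hpq),
          val_glue _ _ _ _, {κ, κ'} ∪ S, ?_, fun k hk => ?_⟩
        · have := Finset.card_union_le {κ, κ'} S
          have : ({κ, κ'} : Finset ℕ).card ≤ 2 := Finset.card_le_two
          omega
        · simp only [Finset.mem_union, Finset.mem_insert, Finset.mem_singleton, not_or] at hk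
          rw [h k hk.2, labelProd, labelProd, h1 k hk.1.1, h2 k hk.1.2]
          group
    · obtain ⟨S, hS, h⟩ := exists_labelProd_glue N p q ((ε, p') :: t) s
      refine ⟨_, _, red_glue _ p q s ht hs ?_, val_glue _ _ _ _, S, by omega, h⟩
      rintro a ha b hb rfl
      simp only [List.head?_cons, Option.mem_def, Option.some.injEq] at ha
      subst ha
      rcases s with _ | ⟨⟨δ, q'⟩, s'⟩
      · simp at hb
      · simp only [List.head?_cons, Option.mem_def, Option.some.injEq] at hb
        subst hb
        rintro rfl
        exact hc ⟨q', s', rfl, rfl⟩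

/-! ### Normal forms and the almost retractions. -/

theorem mem_toSubgroup_bot {u : ℤˣ} {p : Cyc} :
    p ∈ toSubgroup (⊥ : Subgroup Cyc) ⊥ u ↔ p = 1 := by
  rcases Int.units_eq_one_or u with rfl | rfl <;> simp [Subgroup.mem_bot]

/-- The transversal for trivial associated subgroups. -/
def univTransversal : NormalWord.TransversalPair Cyc ⊥ ⊥ where
  set _ := Set.univ
  compl u := by
    have : toSubgroup (⊥ : Subgroup Cyc) ⊥ u = ⊥ := by
      ext p; rw [mem_toSubgroup_bot, Subgroup.mem_bot]
    rw [this]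
    exact Subgroup.isComplement_singleton_left.2 rfl

/-- Reduced words as normal words. -/
def toNormalWord (p : Cyc) (t : List (ℤˣ × Cyc)) (h : Red t) : NormalWord univTransversal where
  head := p
  toList := t
  chain := h.imp fun _ _ hab h' => hab (mem_toSubgroup_bot.1 h')
  mem_set := fun _ _ _ => Set.mem_univ _

theorem val_injective {p q : Cyc} {t s : List (ℤˣ × Cyc)} (ht : Red t) (hs : Red s)
    (h : val p t = val q s) : p = q ∧ t = s := by
  have := NormalWord.prod_injective (MulEquiv.refl _) univTransversal
    (a₁ := toNormalWord p t ht) (a₂ := toNormalWord q s hs) h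
  exact ⟨congrArg (fun w => w.head) this, congrArg (fun w => w.toList) this⟩

theorem exists_val (l : TwoFree) : ∃ p t, Red t ∧ val p t = l := by
  let w := NormalWord.equiv (MulEquiv.refl _) univTransversal l
  refine ⟨w.head, w.toList, w.chain.imp fun _ _ hab h' => hab (mem_toSubgroup_bot.2 h'), ?_⟩
  exact (NormalWord.equiv (MulEquiv.refl _) univTransversal).symm_apply_apply l

/-- The almost retractions onto the free subgroup. -/
noncomputable def almostRetraction (k : ℕ) (l : TwoFree) : BaseFree :=
  labelProd N k (exists_val l).choose (exists_val l).choose_spec.choose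

theorem almostRetraction_val (k : ℕ) {p : Cyc} {t : List (ℤˣ × Cyc)} (ht : Red t) :
    almostRetraction N k (val p t) = labelProd N k p t := by
  have h := (exists_val (val p t)).choose_spec.choose_spec
  obtain ⟨h1, h2⟩ := val_injective h.1 ht h.2
  rw [almostRetraction, h2, h1]

theorem exists_almostRetraction_div (l l' : TwoFree) : ∃ S : Finset ℕ, S.card ≤ 6 ∧ ∀ k ∉ S,
    almostRetraction N k (l⁻¹ * l') = (almostRetraction N k l)⁻¹ * almostRetraction N k l' := by
  obtain ⟨p, t, ht, rfl⟩ := exists_val l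
  obtain ⟨q, s, hs, rfl⟩ := exists_val l'
  obtain ⟨r, x, hx, hv, S, hS, h⟩ := exists_div N t p q s ht hs
  refine ⟨S, hS, fun k hk => ?_⟩
  rw [← hv, almostRetraction_val N k hx, almostRetraction_val N k ht, almostRetraction_val N k hs,
    h k hk]

end Label

end TwoFree

end QuadEq

namespace QuadEq

namespace TwoFree

open HNNExtension

/-! ### The embedding of the free group and its left inverses. -/

section Embedding

variable (N : ℕ)

/-- The word `gap j 0 * t * gap j 1 * ⋯ * t * gap j s`. -/
noncomputable def longWord (j : ℕ) : ℕ → TwoFree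
  | 0 => of (gap j 0)
  | s + 1 => longWord j s * HNNExtension.t * of (gap j (s + 1))

/-- The embedding of the free group of countable rank. -/
noncomputable def embed : BaseFree →* TwoFree :=
  FreeGroup.lift fun o => o.elim HNNExtension.t fun j => longWord j (N + 2)

/-- Left multiplication of a word by `longWord j s`. -/
def up (j : ℕ) : ℕ → Cyc × List (ℤˣ × Cyc) → Cyc × List (ℤˣ × Cyc)
  | 0, x => (gap j 0 * x.1, x.2)
  | s + 1, x => up j s (1, (1, gap j (s + 1) * x.1) :: x.2)

/-- Left multiplication of a word by the inverse of `longWord j s`. -/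
def down (j : ℕ) : ℕ → Cyc × List (ℤˣ × Cyc) → Cyc × List (ℤˣ × Cyc)
  | 0, x => ((gap j 0)⁻¹ * x.1, x.2)
  | s + 1, x => ((gap j (s + 1))⁻¹, (-1, (down j s x).1) :: (down j s x).2)

theorem val_up (j s : ℕ) : ∀ x, val (up j s x).1 (up j s x).2 = longWord j s * val x.1 x.2 := by
  induction s with
  | zero => intro x; simp [up, longWord, of_mul_val]
  | succ s ih =>
    intro x
    rw [up, ih, val_cons, longWord, ← of_mul_val]
    simp [mul_assoc]

theorem val_down (j s : ℕ) (x : Cyc × List (ℤˣ × Cyc)) :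
    val (down j s x).1 (down j s x).2 = (longWord j s)⁻¹ * val x.1 x.2 := by
  induction s with
  | zero => simp [down, longWord, ← of_mul_val]
  | succ s ih =>
    rw [down, val_cons, ih, longWord]
    simp [mul_assoc]

theorem up_eq (j s : ℕ) : ∀ x, ∃ r, up j (s + 2) x = (gap j 0, (1, gap j 1) :: r) := by
  induction s with
  | zero => intro x; simp [up]
  | succ s ih => intro x; rw [up]; exact ih _

theorem red_up (j s : ℕ) : ∀ x, Red x.2 → (∀ b ∈ x.2.head?, gap j s * x.1 = 1 → b.1 = 1) →
    Red (up j s x).2 := by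
  induction s with
  | zero => intro x hx _; exact hx
  | succ s ih =>
    intro x hx h
    refine ih _ (List.isChain_cons.2 ⟨fun b hb h1 => (h b hb h1).symm, hx⟩) ?_
    simp

theorem red_down (j s : ℕ) (x : Cyc × List (ℤˣ × Cyc)) (hx : Red x.2)
    (h : ∀ b ∈ x.2.head?, (gap j 0)⁻¹ * x.1 = 1 → b.1 = -1) : Red (down j s x).2 := by
  induction s with
  | zero => exact hx
  | succ s ih =>
    refine List.isChain_cons.2 ⟨fun b hb h1 => ?_, ih⟩
    rcases s with _ | s
    · exact (h b hb h1).symm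
    · exact absurd (inv_eq_one.1 h1) (gap_ne_one _ _)

variable {N} {k : ℕ}

/-- The product of the labels in `longWord j s`. -/
noncomputable def partialLabel (N k j : ℕ) : ℕ → BaseFree
  | 0 => 1
  | s + 1 => partialLabel N k j s * labelPos N k (gap j s) (gap j (s + 1))

theorem partialLabel_of_lt (j s : ℕ) (h : s < k) : partialLabel N k j s = c ^ s := by
  induction s with
  | zero => rfl
  | succ s ih =>
    rw [partialLabel, ih (by omega), labelPos_of_ne, pow_succ]
    intro j' _ h2
    have := (gap_inj.1 h2).2
    omega

theorem partialLabel_add (hk : 1 ≤ k) (j s : ℕ) :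
    partialLabel N k j (k + s) = c ^ (k - 1) * mark N j k * c ^ s := by
  induction s with
  | zero =>
    obtain ⟨k, rfl⟩ := Nat.exists_eq_add_of_le' hk
    rw [add_zero, partialLabel, partialLabel_of_lt j k (by omega)]
    have := labelPos_gap N j (k + 1)
    simp only [add_tsub_cancel_right] at this
    simp [this]
  | succ s ih =>
    rw [← add_assoc, partialLabel, ih, labelPos_of_ne, pow_succ, mul_assoc _ (c ^ s)]
    intro j' _ h2
    have := (gap_inj.1 h2).2
    omega

/-- The powers of `c` in `mark` cancel the labels of the `k - 1` stable letters before the marked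
one and of the `N + 2 - k` after it. -/
theorem partialLabel_full (hk : 1 ≤ k) (hk' : k ≤ N + 2) (j : ℕ) :
    partialLabel N k j (N + 2) = y j := by
  obtain ⟨s, hs⟩ := Nat.exists_eq_add_of_le hk'
  rw [hs, partialLabel_add hk, mark, hs, add_tsub_cancel_left]
  group

/-- The first stable letter has a generic label, whatever precedes it. -/
def StartGeneric (N k : ℕ) (t : List (ℤˣ × Cyc)) : Prop :=
  ∀ p, ∀ b ∈ t.head?, label N k p b.1 b.2 = c ^ (b.1 : ℤ)

theorem StartGeneric.labelProd_eq {t : List (ℤˣ × Cyc)} (h : StartGeneric N k t) (p p' : Cyc) :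
    labelProd N k p t = labelProd N k p' t := by
  rcases t with _ | ⟨⟨ε, q⟩, t⟩
  · rfl
  · rw [labelProd, labelProd, h p (ε, q) (by simp), h p' (ε, q) (by simp)]

theorem labelProd_up_one (j s : ℕ) : ∀ r t,
    labelProd N k (up j s (1, (1, r) :: t)).1 (up j s (1, (1, r) :: t)).2 =
      partialLabel N k j s * labelPos N k (gap j s) r * labelProd N k r t := by
  induction s with
  | zero => intro r t; simp [up, labelProd, partialLabel, label]
  | succ s ih =>
    intro r t
    rw [up, ih]
    simp [partialLabel, labelProd, label, mul_assoc]

/-- The last syllable of the long word merges with `x.1`, and the result could by accident be some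
`gap`. This is harmless: the stable letter before it follows `gap j (N + 1)`, so it could be marked
only for `k = N + 2`. -/
theorem labelProd_up (hk : 2 ≤ k) (hk' : k ≤ N + 1) (j : ℕ) (x : Cyc × List (ℤˣ × Cyc))
    (hx : StartGeneric N k x.2) :
    labelProd N k (up j (N + 2) x).1 (up j (N + 2) x).2 = y j * labelProd N k x.1 x.2 := by
  have key : ∀ q, labelPos N k (gap j (N + 1)) q = c := by
    intro q
    refine labelPos_of_ne N fun j' h _ => ?_
    have := (gap_inj.1 h).2
    omega
  have hfull : partialLabel N k j (N + 1) * c = y j := by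
    rw [← partialLabel_full (by omega) (by omega : k ≤ N + 2) j, ← key (gap j (N + 2))]
    rfl
  rw [up, labelProd_up_one, key, hfull, hx.labelProd_eq _ x.1]

theorem labelProd_down (hk : 2 ≤ k) (j s : ℕ) (x : Cyc × List (ℤˣ × Cyc))
    (hx : StartGeneric N k x.2) :
    labelProd N k (down j s x).1 (down j s x).2 =
      (partialLabel N k j s)⁻¹ * labelProd N k x.1 x.2 := by
  induction s with
  | zero => simp [down, partialLabel, hx.labelProd_eq _ x.1]
  | succ s ih =>
    -- For `s = 0` the syllable `gap j 0` has merged with `x.1`, but a stable letter next to a `gap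
    -- j 1` could be marked only for `k = 1`.
    have key : labelPos N k ((down j s x).1)⁻¹ (gap j (s + 1)) =
        labelPos N k (gap j s) (gap j (s + 1)) := by
      rcases s with _ | s
      · have : ∀ p, labelPos N k p (gap j (0 + 1)) = c := fun p => by
          refine labelPos_of_ne N fun j' _ h => ?_
          have := (gap_inj.1 h).2
          omega
        rw [this, this]
      · simp [down]
    simp only [down, labelProd, ih, partialLabel, mul_inv_rev]
    simp [label, key, mul_assoc]

/-- The word representing the image of an element under `embed`. -/
def wordOf (N : ℕ) : List (Option ℕ × Bool) → Cyc × List (ℤˣ × Cyc)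
  | [] => (1, [])
  | (none, b) :: t => (1, (bif b then 1 else -1, (wordOf N t).1) :: (wordOf N t).2)
  | (some j, true) :: t => up j (N + 2) (wordOf N t)
  | (some j, false) :: t => down j (N + 2) (wordOf N t)

/-- The possible beginnings of `wordOf`. -/
theorem wordOf_head (N : ℕ) (t : List (Option ℕ × Bool)) :
    (t = [] ∧ wordOf N t = (1, [])) ∨
    (∃ b t', t = (none, b) :: t' ∧ (wordOf N t).1 = 1 ∧
      (wordOf N t).2.head? = some (bif b then 1 else -1, (wordOf N t').1)) ∨
    (∃ j t', t = (some j, true) :: t' ∧ (wordOf N t).1 = gap j 0 ∧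
      (wordOf N t).2.head? = some (1, gap j 1)) ∨
    (∃ j t', t = (some j, false) :: t' ∧ (wordOf N t).1 = (gap j (N + 2))⁻¹ ∧
      (wordOf N t).2.head? = some (-1, (gap j (N + 1))⁻¹)) := by
  rcases t with _ | ⟨⟨_ | j, b⟩, t⟩
  · exact Or.inl ⟨rfl, rfl⟩
  · exact Or.inr (Or.inl ⟨b, t, rfl, rfl, rfl⟩)
  · cases b
    · exact Or.inr (Or.inr (Or.inr ⟨j, t, rfl, rfl, rfl⟩))
    · obtain ⟨r, hr⟩ := up_eq j N (wordOf N t)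
      exact Or.inr (Or.inr (Or.inl ⟨j, t, rfl, by rw [wordOf, hr], by rw [wordOf, hr]; rfl⟩))

/-- The syllable before the first stable letter is the one that merges with what stands to the left.
The bounds on `k` ensure that the syllable after it already rules out a mark. -/
theorem startGeneric_wordOf (hk : 2 ≤ k) (hk' : k ≤ N + 1) (t : List (Option ℕ × Bool)) :
    StartGeneric N k (wordOf N t).2 := by
  intro p b hb
  rw [Option.mem_def] at hb
  rcases wordOf_head N t with ⟨_, h⟩ | ⟨b', t', _, _, h⟩ | ⟨j, t', _, _, h⟩ | ⟨j, t', _, _, h⟩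
  · simp [h] at hb
  · rw [h] at hb
    obtain rfl := Option.some.inj hb
    have hq : (∀ i, (wordOf N t').1 ≠ gap i k) ∧ ∀ i, ((wordOf N t').1)⁻¹ ≠ gap i (k - 1) := by
      rcases wordOf_head N t' with ⟨_, h⟩ | ⟨_, _, _, h, _⟩ | ⟨j, _, _, h, _⟩ | ⟨j, _, _, h, _⟩
      · simp [h, one_ne_gap]
      · simp [h, one_ne_gap]
      · rw [h]
        exact ⟨fun i h => by have := (gap_inj.1 h).2; omega, fun i => gap_inv_ne_gap _ _ _ _⟩
      · rw [h, inv_inv]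
        exact ⟨fun i => gap_inv_ne_gap _ _ _ _, fun i h => by have := (gap_inj.1 h).2; omega⟩
    cases b'
    · simp only [cond_false, label]
      rw [labelPos_of_ne N fun j h => absurd h (hq.2 j)]
      simp
    · simp only [cond_true, label]
      rw [labelPos_of_ne N fun j _ => hq.1 j]
      simp
  · rw [h] at hb
    obtain rfl := Option.some.inj hb
    simp only [label]
    rw [labelPos_of_ne N fun j _ h => by have := (gap_inj.1 h).2; omega]
    simp
  · rw [h] at hb
    obtain rfl := Option.some.inj hb
    have : labelPos N k (gap j (N + 1)) p⁻¹ = c :=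
      labelPos_of_ne N fun j h => by have := (gap_inj.1 h).2; omega
    simp [label, this]

/-- A junction syllable between stable letters of opposite signs is trivial only if a letter meets
its own inverse; junctions between equal signs need no check. -/
theorem red_wordOf (N : ℕ) (t : List (Option ℕ × Bool)) (ht : FreeGroup.IsReduced t) :
    Red (wordOf N t).2 := by
  induction t with
  | nil => exact List.isChain_nil
  | cons x t ih =>
    have ht' := List.isChain_cons.1 ht
    specialize ih ht'.2
    obtain ⟨o, b⟩ := x
    have hx := ht'.1
    cases o with
    | none =>
      refine List.isChain_cons.2 ⟨fun b' hb' h1 => ?_, ih⟩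
      rcases wordOf_head N t with ⟨_, h⟩ | ⟨b₁, t', rfl, _, h⟩ | ⟨j, t', _, h, _⟩ | ⟨j, t', _, h, _⟩
      · simp [h] at hb'
      · rw [h] at hb'
        obtain rfl := Option.some.inj hb'
        have : b = b₁ := hx (none, b₁) (by simp) rfl
        simp [this]
      · exact absurd (h.symm.trans h1) (gap_ne_one _ _)
      · exact absurd (inv_eq_one.1 (h.symm.trans h1)) (gap_ne_one _ _)
    | some j =>
      cases b with
      | true =>
        refine red_up _ _ _ ih fun b' hb' h1 => ?_
        rcases wordOf_head N t with ⟨_, h⟩ | ⟨b₁, t', _, h, _⟩ | ⟨i, t', _, _, h⟩ | ⟨i, t', rfl, h, _⟩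
        · simp [h] at hb'
        · rw [h, mul_one] at h1
          exact absurd h1 (gap_ne_one _ _)
        · rw [h] at hb'
          obtain rfl := Option.some.inj hb'
          rfl
        · rw [h, mul_inv_eq_one, gap_inj] at h1
          have := hx (some i, false) (by simp) (by rw [h1.1])
          simp at this
      | false =>
        refine red_down _ _ _ ih fun b' hb' h1 => ?_
        rcases wordOf_head N t with ⟨_, h⟩ | ⟨b₁, t', _, h, _⟩ | ⟨i, t', rfl, h, _⟩ | ⟨i, t', _, _, h⟩
        · simp [h] at hb'
        · rw [h, mul_one, inv_eq_one] at h1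
          exact absurd h1 (gap_ne_one _ _)
        · rw [h, inv_mul_eq_one, gap_inj] at h1
          have := hx (some i, true) (by simp) (by rw [h1.1])
          simp at this
        · rw [h] at hb'
          obtain rfl := Option.some.inj hb'
          rfl

theorem mk_cons {α : Type*} (x : α) (b : Bool) (t : List (α × Bool)) :
    FreeGroup.mk ((x, b) :: t) = (bif b then FreeGroup.of x else (FreeGroup.of x)⁻¹) *
      FreeGroup.mk t := by
  cases b <;> simp [FreeGroup.of, FreeGroup.inv_mk, FreeGroup.mul_mk, FreeGroup.invRev]

theorem val_wordOf (N : ℕ) (t : List (Option ℕ × Bool)) :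
    val (wordOf N t).1 (wordOf N t).2 = embed N (FreeGroup.mk t) := by
  induction t with
  | nil => simp [wordOf, val, FreeGroup.one_eq_mk.symm]
  | cons x t ih =>
    obtain ⟨o, b⟩ := x
    rw [mk_cons, map_mul, ← ih]
    rcases o with _ | j <;> cases b <;> simp [wordOf, val_cons, val_up, val_down, embed]

theorem labelProd_wordOf (hk : 2 ≤ k) (hk' : k ≤ N + 1) (t : List (Option ℕ × Bool)) :
    labelProd N k (wordOf N t).1 (wordOf N t).2 = FreeGroup.mk t := by
  induction t with
  | nil => simp [wordOf, labelProd, FreeGroup.one_eq_mk.symm]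
  | cons x t ih =>
    obtain ⟨o, b⟩ := x
    rw [mk_cons]
    have hs := startGeneric_wordOf hk hk' t
    rcases o with _ | j
    · rw [← ih]
      have : label N k 1 (bif b then 1 else -1) (wordOf N t).1 =
          bif b then FreeGroup.of none else (FreeGroup.of none)⁻¹ := by
        have := startGeneric_wordOf hk hk' ((none, b) :: t) 1 _ (by rw [wordOf]; rfl)
        rw [this]
        cases b <;> simp [c]
      rw [← this]
      rfl
    · cases b
      · rw [wordOf, labelProd_down hk j _ _ hs, partialLabel_full (by omega) (by omega), ih]
        rfl
      · rw [wordOf, labelProd_up hk hk' j _ hs, ih]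
        rfl

theorem almostRetraction_embed (hk : 2 ≤ k) (hk' : k ≤ N + 1) (e : BaseFree) :
    almostRetraction N k (embed N e) = e := by
  have h := val_wordOf N e.toWord
  rw [FreeGroup.mk_toWord] at h
  rw [← h, almostRetraction_val N k (red_wordOf N _ FreeGroup.isReduced_toWord),
    labelProd_wordOf hk hk', FreeGroup.mk_toWord]

/-- This is what makes two generators suffice: the images of all basis elements lie in the subgroup
generated by the image of `c` and the cyclic factor. -/
theorem longWord_mem (N j s : ℕ) : longWord j s ∈
    Subgroup.closure {embed N (FreeGroup.of none), of (Multiplicative.ofAdd 1)} := by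
  have hp : ∀ p : Cyc, (of p : TwoFree) ∈
      Subgroup.closure {embed N (FreeGroup.of none), of (Multiplicative.ofAdd 1)} := by
    intro p
    have : p = (Multiplicative.ofAdd 1) ^ (Multiplicative.toAdd p) := by
      rw [← ofAdd_zsmul]; simp
    rw [this, map_zpow]
    exact Subgroup.zpow_mem _ (Subgroup.subset_closure (by simp)) _
  induction s with
  | zero => exact hp _
  | succ s ih =>
    refine Subgroup.mul_mem _ (Subgroup.mul_mem _ ih (Subgroup.subset_closure ?_)) (hp _)
    simp [embed]

end Embedding

end TwoFree

end QuadEq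

namespace QuadEq

/-! ### Words with constants and variables, and systems of quadratic words -/

section Words

variable {E Γ Δ : Type*} {V : Type v}

/-- The number of occurrences of variables. -/
def numVar (S : List (E ⊕ V × Bool)) : ℕ := S.countP fun x => x.isRight

open Classical in
/-- The number of occurrences of a variable. -/
noncomputable def occ (x : V) (S : List (E ⊕ V × Bool)) : ℕ :=
  S.countP fun z => ∃ b, z = .inr (x, b)

@[simp] theorem numVar_nil : numVar ([] : List (E ⊕ V × Bool)) = 0 := rfl

@[simp] theorem numVar_inl (e : E) (S : List (E ⊕ V × Bool)) :
    numVar (.inl e :: S) = numVar S := by simp [numVar]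

@[simp] theorem numVar_inr (z : V × Bool) (S : List (E ⊕ V × Bool)) :
    numVar (.inr z :: S) = numVar S + 1 := List.countP_cons_of_pos rfl

@[simp] theorem numVar_append (S T : List (E ⊕ V × Bool)) :
    numVar (S ++ T) = numVar S + numVar T := by simp [numVar]

@[simp] theorem occ_nil (x : V) : occ x ([] : List (E ⊕ V × Bool)) = 0 := rfl

@[simp] theorem occ_inl (x : V) (e : E) (S : List (E ⊕ V × Bool)) :
    occ x (.inl e :: S) = occ x S := by simp [occ]

open Classical in
theorem occ_inr (x : V) (z : V × Bool) (S : List (E ⊕ V × Bool)) :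
    occ x (.inr z :: S) = occ x S + if z.1 = x then 1 else 0 := by
  obtain ⟨z, b⟩ := z
  cases b <;> simp [occ, List.countP_cons]

@[simp] theorem occ_append (x : V) (S T : List (E ⊕ V × Bool)) :
    occ x (S ++ T) = occ x S + occ x T := by simp [occ]

theorem exists_append_of_occ {x : V} {S : List (E ⊕ V × Bool)} (h : occ x S ≠ 0) :
    ∃ a b a', S = a ++ .inr (x, b) :: a' := by
  classical
  obtain ⟨z, hz, hz'⟩ := List.countP_pos_iff.1 (Nat.pos_of_ne_zero h)
  obtain ⟨b, rfl⟩ := of_decide_eq_true hz'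
  obtain ⟨a, a', rfl⟩ := List.append_of_mem hz
  exact ⟨a, b, a', rfl⟩

theorem exists_append_of_numVar {S : List (E ⊕ V × Bool)} (h : 0 < numVar S) :
    ∃ a x b a', S = a ++ .inr (x, b) :: a' := by
  obtain ⟨z, hz, hz'⟩ := List.countP_pos_iff.1 h
  obtain ⟨a, a', rfl⟩ := List.append_of_mem hz
  rcases z with e | ⟨x, b⟩
  · simp at hz'
  · exact ⟨a, x, b, a', rfl⟩

theorem two_mul_length_le (sys : List (List (E ⊕ V × Bool))) (h : ∀ S ∈ sys, 2 ≤ numVar S) :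
    2 * sys.length ≤ numVar sys.flatten := by
  induction sys with
  | nil => simp
  | cons S sys ih =>
    have := ih fun T hT => h T (by simp [hT])
    have := h S (by simp)
    simp only [List.length_cons, List.flatten_cons, numVar_append]
    omega

theorem occ_le_flatten {sys : List (List (E ⊕ V × Bool))} {S : List (E ⊕ V × Bool)}
    (hS : S ∈ sys) (x : V) : occ x S ≤ occ x sys.flatten := by
  obtain ⟨r, r', rfl⟩ := List.append_of_mem hS
  simp only [List.flatten_append, List.flatten_cons, occ_append]
  omega

theorem exists_occ_of_flatten {sys : List (List (E ⊕ V × Bool))} {x : V}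
    (h : occ x sys.flatten ≠ 0) : ∃ S ∈ sys, occ x S ≠ 0 := by
  induction sys with
  | nil => simp at h
  | cons S sys ih =>
    by_cases hS : occ x S = 0
    · obtain ⟨T, hT, h'⟩ := ih (by simpa [hS] using h)
      exact ⟨T, by simp [hT], h'⟩
    · exact ⟨S, by simp, hS⟩

variable [Group E] [Group Γ] [Group Δ]

/-- The value of a letter. -/
def evalLetter (ι : E →* Γ) (f : V → Γ) : E ⊕ V × Bool → Γ
  | .inl e => ι e
  | .inr (x, b) => bif b then f x else (f x)⁻¹

/-- The value of a word with constants in `E` and variables in `V`. -/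
def evalWord (ι : E →* Γ) (f : V → Γ) (S : List (E ⊕ V × Bool)) : Γ :=
  (S.map (evalLetter ι f)).prod

@[simp] theorem evalWord_nil (ι : E →* Γ) (f : V → Γ) : evalWord ι f [] = 1 := rfl

@[simp] theorem evalWord_cons (ι : E →* Γ) (f : V → Γ) (z : E ⊕ V × Bool)
    (S : List (E ⊕ V × Bool)) :
    evalWord ι f (z :: S) = evalLetter ι f z * evalWord ι f S := by simp [evalWord]

@[simp] theorem evalWord_append (ι : E →* Γ) (f : V → Γ) (S T : List (E ⊕ V × Bool)) :
    evalWord ι f (S ++ T) = evalWord ι f S * evalWord ι f T := by simp [evalWord]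

theorem evalWord_congr (ι : E →* Γ) {f g : V → Γ} {S : List (E ⊕ V × Bool)}
    (h : ∀ x, occ x S ≠ 0 → f x = g x) : evalWord ι f S = evalWord ι g S := by
  induction S with
  | nil => rfl
  | cons z S ih =>
    rcases z with e | ⟨x, b⟩
    · simp only [evalWord_cons]
      rw [ih fun x hx => h x (by simpa using hx)]
      rfl
    · simp only [evalWord_cons]
      rw [ih fun x hx => h x (by rw [occ_inr]; omega), evalLetter, evalLetter,
        h x (by rw [occ_inr]; simp)]

theorem evalWord_comp (ι : E →* Γ) (φ : Γ →* Δ) (f : V → Γ) (S : List (E ⊕ V × Bool)) :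
    evalWord (φ.comp ι) (fun x => φ (f x)) S = φ (evalWord ι f S) := by
  induction S with
  | nil => simp
  | cons z S ih =>
    rcases z with e | ⟨x, _ | _⟩ <;> simp [ih, evalLetter]

theorem evalWord_mem_range (ι : E →* Γ) (f : V → Γ) (S : List (E ⊕ V × Bool))
    (h : numVar S = 0) : evalWord ι f S ∈ ι.range := by
  induction S with
  | nil => exact one_mem _
  | cons z S ih =>
    rcases z with e | z
    · rw [evalWord_cons]
      exact mul_mem ⟨e, rfl⟩ (ih (by simpa using h))
    · simp at h

/-- The formal inverse of a word. -/
def invWord (S : List (E ⊕ V × Bool)) : List (E ⊕ V × Bool) :=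
  (S.map (Sum.map (·⁻¹) fun z => (z.1, !z.2))).reverse

theorem evalWord_invWord (ι : E →* Γ) (f : V → Γ) (S : List (E ⊕ V × Bool)) :
    evalWord ι f (invWord S) = (evalWord ι f S)⁻¹ := by
  induction S with
  | nil => simp [invWord]
  | cons z S ih =>
    have : invWord (z :: S) = invWord S ++ [Sum.map (·⁻¹) (fun z => (z.1, !z.2)) z] := by
      simp [invWord]
    rw [this, evalWord_append, ih]
    rcases z with e | ⟨x, _ | _⟩ <;> simp [evalLetter]

theorem occ_invWord (x : V) (S : List (E ⊕ V × Bool)) : occ x (invWord S) = occ x S := by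
  induction S with
  | nil => rfl
  | cons z S ih =>
    have : invWord (z :: S) = invWord S ++ [Sum.map (·⁻¹) (fun z => (z.1, !z.2)) z] := by
      simp [invWord]
    rw [this, occ_append, ih]
    rcases z with e | ⟨x, b⟩ <;> simp [occ_inr]

theorem numVar_invWord (S : List (E ⊕ V × Bool)) : numVar (invWord S) = numVar S := by
  induction S with
  | nil => rfl
  | cons z S ih =>
    have : invWord (z :: S) = invWord S ++ [Sum.map (·⁻¹) (fun z => (z.1, !z.2)) z] := by
      simp [invWord]
    rw [this, numVar_append, ih]
    rcases z with e | ⟨x, b⟩ <;> simp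

/-- Every equation with at most `M` occurrences of variables that is soluble in `Γ` is soluble
in `E`. -/
def EquationallyClosed (V : Type v) (ι : E →* Γ) (M : ℕ) : Prop :=
  ∀ (S : List (E ⊕ V × Bool)) (f : V → Γ), numVar S ≤ M → evalWord ι f S = 1 →
    ∃ f' : V → E, evalWord (MonoidHom.id E) f' S = 1

/-- A variable that is the only one in a word with trivial value can be solved for, so its value is
a product of constants. -/
theorem two_le_numVar {ι : E →* Γ} {f : V → Γ} {S : List (E ⊕ V × Bool)}
    (h : 0 < numVar S) (h1 : evalWord ι f S = 1) (hf : ∀ x, occ x S ≠ 0 → f x ∉ ι.range) :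
    2 ≤ numVar S := by
  obtain ⟨a, x, b, a', rfl⟩ := exists_append_of_numVar h
  by_contra hlt
  simp only [numVar_append, numVar_inr] at hlt
  have ha := evalWord_mem_range ι f a (by omega)
  have ha' := evalWord_mem_range ι f a' (by omega)
  refine hf x (by simp [occ_inr]) ?_
  have h2 : evalLetter ι f (.inr (x, b)) = (evalWord ι f a)⁻¹ * (evalWord ι f a')⁻¹ := by
    rw [evalWord_append, evalWord_cons] at h1
    rw [eq_inv_mul_iff_mul_eq, eq_inv_iff_mul_eq_one, mul_assoc]
    exact h1
  have h3 : evalLetter ι f (.inr (x, b)) ∈ ι.range := by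
    rw [h2]
    exact mul_mem (inv_mem ha) (inv_mem ha')
  cases b
  · simpa [evalLetter] using inv_mem h3
  · exact h3

/-- Eliminating a variable that occurs in two words. -/
def eliminate (a a' t t' : List (E ⊕ V × Bool)) (b b' : Bool) : List (E ⊕ V × Bool) :=
  t ++ ((if b = b' then invWord (a' ++ a) else a' ++ a) ++ t')

theorem numVar_eliminate (a a' t t' : List (E ⊕ V × Bool)) (b b' : Bool) :
    numVar (eliminate a a' t t' b b') = numVar a + numVar a' + numVar t + numVar t' := by
  rw [eliminate]
  split_ifs <;> simp [numVar_invWord] <;> omega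

theorem occ_eliminate (x : V) (a a' t t' : List (E ⊕ V × Bool)) (b b' : Bool) :
    occ x (eliminate a a' t t' b b') = occ x a + occ x a' + occ x t + occ x t' := by
  rw [eliminate]
  split_ifs <;> simp [occ_invWord] <;> omega

theorem evalWord_eliminate {ι : E →* Γ} {f : V → Γ} {a a' : List (E ⊕ V × Bool)} {x : V} {b : Bool}
    (h : evalWord ι f (a ++ .inr (x, b) :: a') = 1) (t t' : List (E ⊕ V × Bool)) (b' : Bool) :
    evalWord ι f (eliminate a a' t t' b b') = evalWord ι f (t ++ .inr (x, b') :: t') := by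
  have h2 : evalLetter ι f (.inr (x, b)) = (evalWord ι f a)⁻¹ * (evalWord ι f a')⁻¹ := by
    rw [evalWord_append, evalWord_cons] at h
    rw [eq_inv_mul_iff_mul_eq, eq_inv_iff_mul_eq_one, mul_assoc]
    exact h
  have h3 : (evalLetter ι f (.inr (x, b)))⁻¹ = evalWord ι f a' * evalWord ι f a := by
    rw [h2]; group
  rw [eliminate]
  split_ifs with hb
  · subst hb
    simp [evalWord_invWord, h2, mul_assoc]
  · have : evalLetter ι f (.inr (x, b')) = (evalLetter ι f (.inr (x, b)))⁻¹ := by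
      clear h h2 h3
      cases b <;> cases b' <;> simp_all [evalLetter]
    rw [evalWord_append, evalWord_append, evalWord_append, evalWord_append, evalWord_cons, this, h3]

/-- A system of words in which every variable occurs exactly twice, with a bound on its Euler
characteristic, and whose solution has no values in `E`, can be solved in `E`. -/
theorem exists_solution_of_system {ι : E →* Γ} {B : ℕ}
    (hι : EquationallyClosed V ι (2 * B + 2)) (n : ℕ) : ∀ (sys : List (List (E ⊕ V × Bool)))
    (f : V → Γ), sys.length = n → (∀ S ∈ sys, evalWord ι f S = 1) → (∀ S ∈ sys, 0 < numVar S) →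
    (∀ x, occ x sys.flatten = 0 ∨ occ x sys.flatten = 2) →
    (∀ x, occ x sys.flatten ≠ 0 → f x ∉ ι.range) →
    numVar sys.flatten ≤ 2 * n + 2 * B →
    ∃ f' : V → E, ∀ S ∈ sys, evalWord (MonoidHom.id E) f' S = 1 := by
  classical
  induction n with
  | zero =>
    intro sys f hn _ _ _ _ _
    rw [List.length_eq_zero_iff] at hn
    subst hn
    exact ⟨fun _ => 1, by simp⟩
  | succ n ih =>
    intro sys f hn h1 hpos hocc hf hnum
    obtain ⟨S, rest, rfl⟩ : ∃ S rest, sys = S :: rest := by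
      rcases sys with _ | ⟨S, rest⟩
      · simp at hn
      · exact ⟨S, rest, rfl⟩
    simp only [List.length_cons, Nat.add_right_cancel_iff] at hn
    simp only [List.flatten_cons, occ_append, numVar_append] at hocc hf hnum
    -- A variable shared by two words occurs once in each. Eliminating it removes one word and two
    -- occurrences, so `numVar` minus twice the number of words is unchanged.
    by_cases hsh : ∃ x, occ x S ≠ 0 ∧ occ x rest.flatten ≠ 0
    · obtain ⟨x, hxS, hxr⟩ := hsh
      obtain ⟨T, hT, hxT⟩ := exists_occ_of_flatten hxr
      obtain ⟨r, r', rfl⟩ := List.append_of_mem hT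
      obtain ⟨a, b, a', rfl⟩ := exists_append_of_occ hxS
      obtain ⟨t, b', t', rfl⟩ := exists_append_of_occ hxT
      have hS1 := h1 (a ++ .inr (x, b) :: a') (by simp)
      have hT1 := h1 (t ++ .inr (x, b') :: t') (by simp)
      simp only [List.flatten_append, List.flatten_cons, occ_append, numVar_append, occ_inr,
        numVar_inr, List.length_append, List.length_cons] at hocc hf hnum hn
      have hx0 : occ x a = 0 ∧ occ x a' = 0 ∧ occ x t = 0 ∧ occ x t' = 0 ∧
          occ x r.flatten = 0 ∧ occ x r'.flatten = 0 := by
        have := hocc x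
        simp only [if_true] at this
        omega
      have hE1 : evalWord ι f (eliminate a a' t t' b b') = 1 := by
        rw [evalWord_eliminate hS1, hT1]
      obtain ⟨f', hf'⟩ := ih (r ++ eliminate a a' t t' b b' :: r') f (by simp; omega) (by
          intro U hU
          simp only [List.mem_append, List.mem_cons] at hU
          rcases hU with hU | rfl | hU
          · exact h1 U (by simp [hU])
          · exact hE1
          · exact h1 U (by simp [hU])) (by
          intro U hU
          simp only [List.mem_append, List.mem_cons] at hU
          rcases hU with hU | rfl | hU
          · exact hpos U (by simp [hU])
          · have := two_le_numVar (hpos (a ++ .inr (x, b) :: a') (by simp)) hS1 (by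
              intro z hz
              refine hf z ?_
              simp only [occ_append, occ_inr] at hz
              omega)
            simp only [numVar_append, numVar_inr] at this
            rw [numVar_eliminate]
            omega
          · exact hpos U (by simp [hU])) (by
          intro z
          simp only [List.flatten_append, List.flatten_cons, occ_append, occ_eliminate]
          by_cases hz : x = z
          · subst hz
            omega
          · have := hocc z
            simp only [hz, if_false] at this
            omega) (by
          intro z hz
          refine hf z ?_
          simp only [List.flatten_append, List.flatten_cons, occ_append, occ_eliminate] at hz
          omega) (by
          simp only [List.flatten_append, List.flatten_cons, numVar_append, numVar_eliminate]
          omega)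
      -- The eliminated variable is recovered from its word: the letter between `a` and `a'` must
      -- take the value `q⁻¹`.
      let q : E := evalWord (MonoidHom.id E) f' (a' ++ a)
      let g : V → E := Function.update f' x (bif b then q⁻¹ else q)
      have hg : ∀ U : List (E ⊕ V × Bool), occ x U = 0 →
          evalWord (MonoidHom.id E) g U = evalWord (MonoidHom.id E) f' U := by
        intro U hU
        refine evalWord_congr _ fun z hz => ?_
        have : z ≠ x := by rintro rfl; exact hz hU
        simp [g, this]
      have hq : evalLetter (MonoidHom.id E) g (.inr (x, b)) = q⁻¹ := by
        cases b <;> simp [evalLetter, g]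
      have hgS : evalWord (MonoidHom.id E) g (a ++ .inr (x, b) :: a') = 1 := by
        rw [evalWord_append, evalWord_cons, hq, hg a hx0.1, hg a' hx0.2.1]
        simp [q]
      refine ⟨g, fun U hU => ?_⟩
      have hrest : ∀ U, U ∈ r ∨ U ∈ r' → occ x U = 0 := by
        rintro U (hU | hU)
        · have := occ_le_flatten hU x
          omega
        · have := occ_le_flatten hU x
          omega
      simp only [List.mem_append, List.mem_cons] at hU
      rcases hU with rfl | hU | rfl | hU
      · exact hgS
      · rw [hg U (hrest U (Or.inl hU))]
        exact hf' U (by simp [hU])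
      · rw [← evalWord_eliminate hgS, hg _ (by rw [occ_eliminate]; omega)]
        exact hf' _ (by simp)
      · rw [hg U (hrest U (Or.inr hU))]
        exact hf' U (by simp [hU])
    · push Not at hsh
      have h2 : ∀ U ∈ S :: rest, 2 ≤ numVar U := by
        intro U hU
        refine two_le_numVar (hpos U hU) (h1 U hU) fun z hz => hf z ?_
        have := occ_le_flatten hU z
        simp only [List.flatten_cons, occ_append] at this
        omega
      -- The other `n` words use at least `2 * n` occurrences, which leaves at most `2 * B + 2` for
      -- `S`. Since `S` itself has at least two, the bound passes to `rest`.
      have h3 := two_mul_length_le rest fun U hU => h2 U (by simp [hU])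
      have h4 := h2 S (by simp)
      obtain ⟨g, hg⟩ := hι S f (by omega) (h1 S (by simp))
      obtain ⟨f', hf'⟩ := ih rest f hn (fun U hU => h1 U (by simp [hU]))
        (fun U hU => hpos U (by simp [hU])) (by
          intro x
          have := hocc x
          by_cases hx : occ x S = 0
          · omega
          · exact Or.inl (hsh x hx)) (fun x hx => hf x (by omega)) (by omega)
      refine ⟨fun x => if occ x S ≠ 0 then g x else f' x, fun U hU => ?_⟩
      rcases List.mem_cons.1 hU with rfl | hU
      · rw [← hg]
        exact evalWord_congr _ fun x hx => if_pos hx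
      · rw [← hf' U hU]
        refine evalWord_congr _ fun x hx => if_neg ?_
        intro hxS
        have := occ_le_flatten hU x
        have := hsh x hxS
        omega

end Words

/-! ### The free subgroup is equationally closed -/

section Closed

variable {V : Type v}

/-- Two quotients are involved, `(l⁻¹)⁻¹ * l'` and `l⁻¹ * 1`, each with six exceptions. -/
theorem TwoFree.exists_almostRetraction_mul (N : ℕ) (l l' : TwoFree) : ∃ S : Finset ℕ, S.card ≤ 12 ∧
    ∀ k ∉ S, 2 ≤ k → k ≤ N + 1 → almostRetraction N k (l * l') =
      almostRetraction N k l * almostRetraction N k l' := by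
  obtain ⟨S, hS, h⟩ := exists_almostRetraction_div N l⁻¹ l'
  obtain ⟨S', hS', h'⟩ := exists_almostRetraction_div N l 1
  refine ⟨S ∪ S', ?_, fun k hk h2 hN => ?_⟩
  · have := Finset.card_union_le S S'
    omega
  · simp only [Finset.mem_union, not_or] at hk
    have h1 : almostRetraction N k 1 = 1 := by
      rw [← map_one (embed N), almostRetraction_embed h2 hN]
    have h3 := h k hk.1
    have h4 := h' k hk.2
    rw [h1, mul_one, mul_one] at h4
    rw [inv_inv] at h3
    rw [h3, h4, inv_inv]

theorem TwoFree.exists_almostRetraction_inv (N : ℕ) (l : TwoFree) : ∃ S : Finset ℕ, S.card ≤ 6 ∧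
    ∀ k ∉ S, 2 ≤ k → k ≤ N + 1 → almostRetraction N k l⁻¹ = (almostRetraction N k l)⁻¹ := by
  obtain ⟨S', hS', h'⟩ := exists_almostRetraction_div N l 1
  refine ⟨S', hS', fun k hk h2 hN => ?_⟩
  have h1 : almostRetraction N k 1 = 1 := by
    rw [← map_one (embed N), almostRetraction_embed h2 hN]
  have h4 := h' k hk
  rwa [h1, mul_one, mul_one] at h4

open TwoFree in
-- Each occurrence of a variable costs two products and one inverse, 12 + 12 + 6 exceptions.
-- Constants cost nothing, since they accumulate in `e` before the retraction is applied; this is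
-- why the bound ignores their number.
theorem exists_almostRetraction_evalWord (N : ℕ) (f : V → TwoFree)
    (S : List (BaseFree ⊕ V × Bool)) : ∀ e : BaseFree, ∃ T : Finset ℕ, T.card ≤ 30 * numVar S ∧
      ∀ k ∉ T, 2 ≤ k → k ≤ N + 1 → almostRetraction N k (embed N e * evalWord (embed N) f S) =
        e * evalWord (MonoidHom.id _) (fun x => almostRetraction N k (f x)) S := by
  induction S with
  | nil =>
    intro e
    exact ⟨∅, by simp, fun k _ h2 hN => by simp [almostRetraction_embed h2 hN]⟩
  | cons z S ih =>
    intro e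
    rcases z with e' | ⟨x, b⟩
    · obtain ⟨T, hT, h⟩ := ih (e * e')
      refine ⟨T, by simpa using hT, fun k hk h2 hN => ?_⟩
      have := h k hk h2 hN
      simpa [evalLetter, mul_assoc] using this
    · obtain ⟨T, hT, h⟩ := ih 1
      obtain ⟨T₁, hT₁, h₁⟩ := exists_almostRetraction_mul N (embed N e)
        (evalLetter (embed N) f (.inr (x, b)) * evalWord (embed N) f S)
      obtain ⟨T₂, hT₂, h₂⟩ := exists_almostRetraction_mul N (evalLetter (embed N) f (.inr (x, b)))
        (evalWord (embed N) f S)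
      obtain ⟨T₃, hT₃, h₃⟩ := exists_almostRetraction_inv N (f x)
      refine ⟨T ∪ T₁ ∪ T₂ ∪ T₃, ?_, fun k hk h2 hN => ?_⟩
      · have := Finset.card_union_le (T ∪ T₁ ∪ T₂) T₃
        have := Finset.card_union_le (T ∪ T₁) T₂
        have := Finset.card_union_le T T₁
        simp only [numVar_inr]
        omega
      · simp only [Finset.mem_union, not_or] at hk
        obtain ⟨⟨⟨hk, hk₁⟩, hk₂⟩, hk₃⟩ := hk
        have h0 := h k hk h2 hN
        simp only [map_one, one_mul] at h0
        rw [evalWord_cons, h₁ k hk₁ h2 hN, h₂ k hk₂ h2 hN, h0, almostRetraction_embed h2 hN,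
          evalWord_cons]
        cases b <;> simp [evalLetter, h₃ k hk₃ h2 hN]

open TwoFree in
theorem equationallyClosed_embed (M : ℕ) : EquationallyClosed V (embed (30 * M + 1)) M := by
  intro S f hS h1
  obtain ⟨T, hT, h⟩ := exists_almostRetraction_evalWord (30 * M + 1) f S 1
  -- There are `30 * M + 1` admissible values of `k` and at most `30 * M` exceptions.
  obtain ⟨k, hk, hkT⟩ : ∃ k ∈ Finset.Icc 2 (30 * M + 2), k ∉ T := by
    by_contra hcon
    push Not at hcon
    have := Finset.card_le_card (show Finset.Icc 2 (30 * M + 2) ⊆ T from hcon)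
    simp only [Nat.card_Icc] at this
    omega
  rw [Finset.mem_Icc] at hk
  have := h k hkT hk.1 (by omega)
  rw [h1, map_one, one_mul, one_mul, ← map_one (embed (30 * M + 1)),
    almostRetraction_embed hk.1 (by omega)] at this
  exact ⟨_, this.symm⟩

open TwoFree in
theorem embed_injective (N : ℕ) (hN : 1 ≤ N) : Function.Injective (embed N) :=
  Function.LeftInverse.injective fun e => almostRetraction_embed (k := 2) le_rfl (by omega) e

end Closed

end QuadEq

namespace QuadEq

/-! ### Amalgamated products -/

section Amalgam

variable {E K L H : Type*} [Group E] [Group L] {V : Type v}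

/-- The alternating list of values of an alternating list of words and weighted elements. -/
def evalTail (ι : E →* L) (f : V → L) (t : List (List (E ⊕ V × Bool) × K × ℕ)) : List (L × K) :=
  t.map fun x => (evalWord ι f x.1, x.2.1)

@[simp] theorem evalTail_nil (ι : E →* L) (f : V → L) :
    evalTail ι f ([] : List (List (E ⊕ V × Bool) × K × ℕ)) = [] := rfl

@[simp] theorem evalTail_cons (ι : E →* L) (f : V → L) (x : List (E ⊕ V × Bool) × K × ℕ)
    (t : List (List (E ⊕ V × Bool) × K × ℕ)) :
    evalTail ι f (x :: t) = (evalWord ι f x.1, x.2.1) :: evalTail ι f t := rfl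

@[simp] theorem evalTail_append (ι : E →* L) (f : V → L)
    (t t' : List (List (E ⊕ V × Bool) × K × ℕ)) :
    evalTail ι f (t ++ t') = evalTail ι f t ++ evalTail ι f t' := by simp [evalTail]

/-- The words of an alternating list. -/
def tailWords (t : List (List (E ⊕ V × Bool) × K × ℕ)) : List (E ⊕ V × Bool) :=
  (t.map Prod.fst).flatten

/-- The total weight of an alternating list. -/
def tailWeight (t : List (List (E ⊕ V × Bool) × K × ℕ)) : ℕ := (t.map fun x => x.2.2).sum

variable [Group K] [Group H]

/-- The product of an alternating list. -/
def altProd (lam : L →* H) (κ : K →* H) (t : List (L × K)) : H :=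
  (t.map fun x => lam x.1 * κ x.2).prod

@[simp] theorem altProd_nil (lam : L →* H) (κ : K →* H) : altProd lam κ [] = 1 := rfl

@[simp] theorem altProd_cons (lam : L →* H) (κ : K →* H) (x : L × K) (t : List (L × K)) :
    altProd lam κ (x :: t) = lam x.1 * κ x.2 * altProd lam κ t := by simp [altProd]

@[simp] theorem altProd_append (lam : L →* H) (κ : K →* H) (t t' : List (L × K)) :
    altProd lam κ (t ++ t') = altProd lam κ t * altProd lam κ t' := by simp [altProd]

/-- The properties of an amalgamated product of `K` and `L` over `E` that are used here. -/
structure IsAmalgam (θ : E →* K) (ι : E →* L) (κ : K →* H) (lam : L →* H) : Prop where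
  injective : Function.Injective κ
  comm : ∀ e, κ (θ e) = lam (ι e)
  exists_altProd : ∀ h : H, ∃ k t, h = κ k * altProd lam κ t
  ne_one : ∀ (k : K) (t : List (L × K)), t ≠ [] → (∀ x ∈ t, x.1 ∉ ι.range) →
    (∀ x ∈ t.dropLast, x.2 ∉ θ.range) → κ k * altProd lam κ t ≠ 1

theorem exists_append_of_mem_dropLast {α : Type*} {x : α} {t : List α} (h : x ∈ t.dropLast) :
    ∃ t₁ z t₂, t = t₁ ++ x :: z :: t₂ := by
  obtain ⟨a, b, hab⟩ := List.append_of_mem h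
  have hne : t ≠ [] := by rintro rfl; simp at h
  have ht := List.dropLast_append_getLast hne
  rw [hab] at ht
  rcases b with _ | ⟨z, b⟩
  · exact ⟨a, t.getLast hne, [], by simpa using ht.symm⟩
  · exact ⟨a, z, b ++ [t.getLast hne], by simpa using ht.symm⟩

variable {θ : E →* K} {ι : E →* L} {κ : K →* H} {lam : L →* H}

namespace IsAmalgam

/-- Every element is the value of a reduced alternating list. -/
theorem exists_reduced (hA : IsAmalgam θ ι κ lam) (h : H) : ∃ k t, h = κ k * altProd lam κ t ∧
    (∀ x ∈ t, x.1 ∉ ι.range) ∧ ∀ x ∈ t.dropLast, x.2 ∉ θ.range := by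
  classical
  -- An expression of least length is reduced: a syllable in the amalgamated subgroup could be
  -- absorbed by its neighbours.
  have hex : ∃ n k, ∃ t : List (L × K), t.length = n ∧ h = κ k * altProd lam κ t := by
    obtain ⟨k, t, ht⟩ := hA.exists_altProd h
    exact ⟨t.length, k, t, rfl, ht⟩
  obtain ⟨k, t, hlen, ht⟩ := Nat.find_spec hex
  have hmin : ∀ k' (t' : List (L × K)), h = κ k' * altProd lam κ t' → t.length ≤ t'.length := by
    intro k' t' h'
    rw [hlen]
    exact Nat.find_min' hex ⟨k', t', rfl, h'⟩
  refine ⟨k, t, ht, ?_, ?_⟩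
  · rintro ⟨l, k₁⟩ hx ⟨e, he⟩
    simp only at he
    subst he
    obtain ⟨t₁, t₂, rfl⟩ := List.append_of_mem hx
    rcases List.eq_nil_or_concat t₁ with rfl | ⟨t₁, ⟨l', k'⟩, rfl⟩
    · have := hmin (k * θ e * k₁) t₂ (by simp [ht, hA.comm, mul_assoc])
      simp at this
    · have := hmin k (t₁ ++ (l', k' * θ e * k₁) :: t₂) (by simp [ht, hA.comm, mul_assoc])
      simp at this
  · rintro ⟨l, k₁⟩ hx ⟨e, he⟩
    simp only at he
    subst he
    obtain ⟨t₁, ⟨l', k'⟩, t₂, rfl⟩ := exists_append_of_mem_dropLast hx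
    have := hmin k (t₁ ++ (l * ι e * l', k') :: t₂) (by simp [ht, hA.comm, mul_assoc])
    simp at this

end IsAmalgam

/-- An element of `K` with a weight; an element of weight one is not in the amalgamated subgroup. -/
def GoodWeight (θ : E →* K) (x : K × ℕ) : Prop := 1 ≤ x.2 ∧ (x.2 = 1 → x.1 ∉ θ.range)

/-- An alternating list with trivial value in an amalgamated product splits into words with trivial
value in the factor `L`. -/
theorem IsAmalgam.exists_split (hA : IsAmalgam θ ι κ lam) (f : V → L) (n : ℕ) :
    ∀ (k : K) (t : List (List (E ⊕ V × Bool) × K × ℕ)), t.length = n →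
    (∀ x ∈ t, 0 < numVar x.1) → (∀ x ∈ t, GoodWeight θ x.2) →
    κ k * altProd lam κ (evalTail ι f t) = 1 →
    ∃ sys : List (List (E ⊕ V × Bool)), (∀ S ∈ sys, 0 < numVar S) ∧
      (∀ S ∈ sys, evalWord ι f S = 1) ∧
      (∀ x, occ x sys.flatten = occ x (tailWords t)) ∧
      numVar sys.flatten = numVar (tailWords t) ∧
      2 * n ≤ 2 * sys.length + tailWeight t ∧
      ∀ f' : V → E, (∀ S ∈ sys, evalWord (MonoidHom.id E) f' S = 1) →
        k * altProd θ (MonoidHom.id K) (evalTail (MonoidHom.id E) f' t) = 1 := by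
  induction n with
  | zero =>
    intro k t ht _ _ h1
    rw [List.length_eq_zero_iff] at ht
    subst ht
    have hk : k = 1 := hA.injective (by simpa using h1)
    exact ⟨[], by simp, by simp, by simp [tailWords], by simp [tailWords], by simp, by simp [hk]⟩
  | succ n ih =>
    intro k t ht hpos hgood h1
    -- By the normal form theorem a nonempty list with trivial value is not reduced. A word with
    -- value in `E` is split off as an equation; a constant in `E` joins its two neighbouring words.
    have hcase : (∃ x ∈ t, evalWord ι f x.1 ∈ ι.range) ∨ ∃ x ∈ t.dropLast, x.2.1 ∈ θ.range := by
      by_contra hcon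
      push Not at hcon
      refine hA.ne_one k (evalTail ι f t) ?_ ?_ ?_ h1
      · intro h
        have := congrArg List.length h
        simp [evalTail, ht] at this
      · intro x hx
        obtain ⟨z, hz, rfl⟩ := List.mem_map.1 hx
        exact hcon.1 z hz
      · intro x hx
        rw [evalTail, ← List.map_dropLast] at hx
        obtain ⟨z, hz, rfl⟩ := List.mem_map.1 hx
        exact hcon.2 z hz
    rcases hcase with ⟨⟨S, k₁, w⟩, hx, e, he⟩ | ⟨⟨S, k₁, w⟩, hx, e, he⟩
    · simp only at he
      have hxpos := hpos _ hx
      have hxgood := hgood _ hx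
      obtain ⟨t₁, t₂, rfl⟩ := List.append_of_mem hx
      have hnew : evalWord ι f (S ++ [.inl e⁻¹]) = 1 := by simp [evalLetter, ← he]
      have hval : ∀ f' : V → E, evalWord (MonoidHom.id E) f' (S ++ [.inl e⁻¹]) = 1 →
          evalWord (MonoidHom.id E) f' S = e := by
        intro f' h
        simpa [evalLetter, mul_inv_eq_one] using h
      rcases List.eq_nil_or_concat t₁ with rfl | ⟨t₁, ⟨S', k', w'⟩, rfl⟩
      · obtain ⟨sys, h2, h3, h4, h5, h6, h7⟩ := ih (k * θ e * k₁) t₂ (by simpa using ht)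
          (fun x hx => hpos x (by simp [hx])) (fun x hx => hgood x (by simp [hx])) (by
            rw [← h1]
            simp [← he, hA.comm, mul_assoc])
        refine ⟨(S ++ [.inl e⁻¹]) :: sys, ?_, ?_, ?_, ?_, ?_, ?_⟩
        · rintro T (_ | ⟨_, hT⟩)
          · simpa using hxpos
          · exact h2 T hT
        · rintro T (_ | ⟨_, hT⟩)
          · exact hnew
          · exact h3 T hT
        · intro x
          have := h4 x
          simp only [tailWords] at this
          simp [tailWords, this]
        · simp only [tailWords] at h5
          simp [tailWords, h5]
        · simp only [tailWeight] at h6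
          simp only [List.length_cons, tailWeight, List.nil_append, List.map_cons, List.sum_cons]
          omega
        · intro f' hf'
          have h8 := h7 f' fun T hT => hf' T (by simp [hT])
          have h9 := hval f' (hf' _ (by simp))
          rw [← h8]
          simp [h9, mul_assoc]
      · have hgood' := hgood (S', k', w') (by simp)
        -- The merged constant may fall into `E`, which is allowed because its weight is now at
        -- least two.
        obtain ⟨sys, h2, h3, h4, h5, h6, h7⟩ := ih k (t₁ ++ (S', k' * θ e * k₁, w' + w) :: t₂)
          (by simp at ht ⊢; omega) (by
            intro x hx
            simp only [List.mem_append, List.mem_cons] at hx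
            rcases hx with hx | rfl | hx
            · exact hpos x (by simp [hx])
            · exact hpos (S', k', w') (by simp)
            · exact hpos x (by simp [hx])) (by
            intro x hx
            simp only [List.mem_append, List.mem_cons] at hx
            rcases hx with hx | rfl | hx
            · exact hgood x (by simp [hx])
            · have a1 := hgood'.1
              have a2 := hxgood.1
              simp only at a1 a2
              exact ⟨by simp only; omega, fun h => by simp only at h; omega⟩
            · exact hgood x (by simp [hx])) (by
            rw [← h1]
            simp [← he, hA.comm, mul_assoc])
        refine ⟨(S ++ [.inl e⁻¹]) :: sys, ?_, ?_, ?_, ?_, ?_, ?_⟩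
        · rintro T (_ | ⟨_, hT⟩)
          · simpa using hxpos
          · exact h2 T hT
        · rintro T (_ | ⟨_, hT⟩)
          · exact hnew
          · exact h3 T hT
        · intro x
          have := h4 x
          simp only [tailWords] at this
          simp [tailWords, this]
          omega
        · simp only [tailWords] at h5
          simp [tailWords, h5]
          omega
        · simp [tailWeight] at h6 ⊢
          omega
        · intro f' hf'
          have h8 := h7 f' fun T hT => hf' T (by simp [hT])
          have h9 := hval f' (hf' _ (by simp))
          rw [← h8]
          simp [h9, mul_assoc]
    · simp only at he
      subst he
      obtain ⟨t₁, ⟨S', k', w'⟩, t₂, rfl⟩ := exists_append_of_mem_dropLast hx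
      have hxgood := hgood (S, θ e, w) (by simp)
      -- Joining two words shortens the list without producing an equation. It is paid for by two
      -- units of weight, whence the inequality between `n`, `sys.length` and `tailWeight`.
      have hw : 2 ≤ w := by
        have a1 := hxgood.1
        have a2 := hxgood.2
        simp only at a1 a2
        have : w ≠ 1 := fun h => a2 h ⟨e, rfl⟩
        omega
      obtain ⟨sys, h2, h3, h4, h5, h6, h7⟩ := ih k (t₁ ++ (S ++ .inl e :: S', k', w') :: t₂)
        (by simp at ht ⊢; omega) (by
          intro x hx
          simp only [List.mem_append, List.mem_cons] at hx
          rcases hx with hx | rfl | hx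
          · exact hpos x (by simp [hx])
          · have := hpos (S', k', w') (by simp)
            simp only [numVar_append, numVar_inl]
            simp only at this
            omega
          · exact hpos x (by simp [hx])) (by
          intro x hx
          simp only [List.mem_append, List.mem_cons] at hx
          rcases hx with hx | rfl | hx
          · exact hgood x (by simp [hx])
          · exact hgood (S', k', w') (by simp)
          · exact hgood x (by simp [hx])) (by
          rw [← h1]
          simp [hA.comm, mul_assoc, evalLetter])
      refine ⟨sys, h2, h3, ?_, ?_, ?_, ?_⟩
      · intro x
        rw [h4 x]
        simp [tailWords]
      · rw [h5]
        simp [tailWords]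
      · simp [tailWeight] at h6 ⊢
        omega
      · intro f' hf'
        rw [← h7 f' hf']
        simp [mul_assoc, evalLetter]

end Amalgam

end QuadEq

namespace QuadEq

/-! ### Existence of amalgamated products -/

section Pushout

open Monoid

variable {E : Type v} {K L : Type u}

/-- The two factors of an amalgamated product as a family. -/
abbrev Factor (K L : Type u) (b : Bool) : Type u := bif b then K else L

/-- The syllables of an alternating list. -/
def syllables (t : List (L × K)) : List (Σ b, Factor K L b) :=
  t.flatMap fun x => [⟨false, x.1⟩, ⟨true, x.2⟩]

theorem isChain_syllables_append (t : List (L × K)) (s : List (Σ b, Factor K L b))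
    (hs : s.IsChain fun a b => a.1 ≠ b.1) (hs' : ∀ a ∈ s.head?, a.1 = false) :
    (syllables t ++ s).IsChain (fun a b => a.1 ≠ b.1) ∧
      ∀ a ∈ (syllables t ++ s).head?, a.1 = false := by
  induction t with
  | nil => exact ⟨hs, hs'⟩
  | cons x t ih =>
    have : syllables (x :: t) ++ s = ⟨false, x.1⟩ :: ⟨true, x.2⟩ :: (syllables t ++ s) := by
      simp [syllables]
    rw [this]
    refine ⟨?_, by simp⟩
    rw [List.isChain_cons_cons]
    refine ⟨by simp, List.isChain_cons.2 ⟨fun a ha => ?_, ih.1⟩⟩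
    rw [ih.2 a ha]
    simp

variable [Group E] [Group K] [Group L]

instance factorGroup (b : Bool) : Group (Factor K L b) :=
  match b with
  | true => inferInstanceAs (Group K)
  | false => inferInstanceAs (Group L)

/-- The two embeddings as a family. -/
def factorHom (θ : E →* K) (ι : E →* L) (b : Bool) : E →* Factor K L b :=
  match b with
  | true => θ
  | false => ι

/-- The amalgamated product of `K` and `L` over `E`. -/
abbrev Amalgam (θ : E →* K) (ι : E →* L) := PushoutI (factorHom θ ι)

/-- The embedding of the first factor. -/
def Amalgam.inl (θ : E →* K) (ι : E →* L) : K →* Amalgam θ ι :=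
  PushoutI.of (φ := factorHom θ ι) true

/-- The embedding of the second factor. -/
def Amalgam.inr (θ : E →* K) (ι : E →* L) : L →* Amalgam θ ι :=
  PushoutI.of (φ := factorHom θ ι) false

theorem prod_syllables (θ : E →* K) (ι : E →* L) (t : List (L × K)) :
    ((syllables t).map fun a => PushoutI.of (φ := factorHom θ ι) a.1 a.2).prod =
      altProd (Amalgam.inr θ ι) (Amalgam.inl θ ι) t := by
  induction t with
  | nil => rfl
  | cons x t ih =>
    have : syllables (x :: t) = ⟨false, x.1⟩ :: ⟨true, x.2⟩ :: syllables t := by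
      simp [syllables]
    rw [this, List.map_cons, List.map_cons, List.prod_cons, List.prod_cons, ih, altProd_cons,
      mul_assoc]
    rfl

theorem eq_nil_of_prod_mem_range {θ : E →* K} {ι : E →* L} (hθ : Function.Injective θ)
    (hι : Function.Injective ι) (s : List (Σ b, Factor K L b))
    (hs : s.IsChain fun a b => a.1 ≠ b.1) (hs' : ∀ a ∈ s, a.2 ∉ (factorHom θ ι a.1).range)
    (h : (s.map fun a => PushoutI.of (φ := factorHom θ ι) a.1 a.2).prod ∈
      (PushoutI.base (factorHom θ ι)).range) : s = [] := by
  let w : CoprodI.Word (Factor K L) := ⟨s, fun a ha h1 => hs' a ha (h1 ▸ one_mem _), hs⟩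
  have hw : PushoutI.Reduced (factorHom θ ι) w := hs'
  have := hw.eq_empty_of_mem_range (by rintro (_ | _); exacts [hι, hθ]) (by
    rw [CoprodI.Word.prod, map_list_prod, List.map_map]
    exact h)
  exact congrArg CoprodI.Word.toList this

theorem isAmalgam_pushout (θ : E →* K) (ι : E →* L) (hθ : Function.Injective θ)
    (hι : Function.Injective ι) : IsAmalgam θ ι (Amalgam.inl θ ι) (Amalgam.inr θ ι) where
  injective := PushoutI.of_injective (φ := factorHom θ ι) (by rintro (_ | _); exacts [hι, hθ]) true
  comm e := by
    have h1 := PushoutI.of_apply_eq_base (factorHom θ ι) true e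
    have h2 := PushoutI.of_apply_eq_base (factorHom θ ι) false e
    exact h1.trans h2.symm
  exists_altProd h := by
    induction h using PushoutI.induction_on with
    | of b g =>
      cases b with
      | true => exact ⟨g, [], by simp [Amalgam.inl]⟩
      | false => exact ⟨1, [(g, 1)], by simp [Amalgam.inr]⟩
    | base e =>
      refine ⟨θ e, [], ?_⟩
      rw [altProd_nil, mul_one]
      exact (PushoutI.of_apply_eq_base (factorHom θ ι) true e).symm
    | mul x y hx hy =>
      obtain ⟨k, t, rfl⟩ := hx
      obtain ⟨k', t', rfl⟩ := hy
      rcases List.eq_nil_or_concat t with rfl | ⟨t, ⟨l, k₁⟩, rfl⟩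
      · exact ⟨k * k', t', by simp [mul_assoc]⟩
      · exact ⟨k, t ++ (l, k₁ * k') :: t', by simp [mul_assoc]⟩
  ne_one k t hne hl hk h1 := by
    rcases List.eq_nil_or_concat t with rfl | ⟨t, ⟨l, k₁⟩, rfl⟩
    · exact hne rfl
    · rw [List.concat_eq_append, List.dropLast_concat] at hk
      rw [List.concat_eq_append] at hl h1
      have hsyl : ∀ a ∈ syllables t, a.2 ∉ (factorHom θ ι a.1).range := by
        intro a ha
        simp only [syllables, List.mem_flatMap, List.mem_cons, List.not_mem_nil, or_false] at ha
        obtain ⟨x, hx, rfl | rfl⟩ := ha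
        · exact hl x (by simp [hx])
        · exact hk x hx
      have hl' : l ∉ ι.range := hl (l, k₁) (by simp)
      -- The unrestricted first and last elements of `K` are brought together by conjugation. If `k₁
      -- * k` lies in the amalgamated subgroup, the rest is a reduced word with value in the base;
      -- otherwise `k₁ * k` is one more reduced syllable.
      have h2 : altProd (Amalgam.inr θ ι) (Amalgam.inl θ ι) t * Amalgam.inr θ ι l =
          (Amalgam.inl θ ι (k₁ * k))⁻¹ := by
        rw [eq_inv_iff_mul_eq_one]
        have := congrArg (fun z => (Amalgam.inl θ ι k)⁻¹ * z * Amalgam.inl θ ι k) h1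
        simpa [mul_assoc] using this
      by_cases hmem : k₁ * k ∈ θ.range
      · have := eq_nil_of_prod_mem_range hθ hι (syllables t ++ [⟨false, l⟩])
          (isChain_syllables_append t _ (by simp) (by simp)).1 (by
            intro a ha
            rcases List.mem_append.1 ha with ha | ha
            · exact hsyl a ha
            · rw [List.mem_singleton.1 ha]
              exact hl') (by
            rw [List.map_append, List.prod_append, prod_syllables, List.map_singleton,
              List.prod_singleton]
            change _ * Amalgam.inr θ ι l ∈ _
            rw [h2]
            obtain ⟨e, he⟩ := hmem
            refine inv_mem ⟨e, ?_⟩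
            rw [← he]
            exact (PushoutI.of_apply_eq_base (factorHom θ ι) true e).symm)
        simp at this
      · have := eq_nil_of_prod_mem_range hθ hι (syllables t ++ [⟨false, l⟩, ⟨true, k₁ * k⟩])
          (isChain_syllables_append t _ (by simp) (by simp)).1 (by
            intro a ha
            rcases List.mem_append.1 ha with ha | ha
            · exact hsyl a ha
            · simp only [List.mem_cons, List.not_mem_nil, or_false] at ha
              rcases ha with rfl | rfl
              · exact hl'
              · exact hmem) (by
            rw [List.map_append, List.prod_append, prod_syllables, List.map_cons,
              List.map_singleton, List.prod_cons, List.prod_singleton]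
            change _ * (Amalgam.inr θ ι l * Amalgam.inl θ ι (k₁ * k)) ∈ _
            rw [← mul_assoc, h2, inv_mul_cancel]
            exact one_mem _)
        simp at this

end Pushout

end QuadEq

namespace QuadEq

/-! ### Quadratic equations over a factor of an amalgamated product -/

section Items

variable {K X : Type*}

open Classical in
/-- The number of occurrences of a variable in a list of weighted constants and variables. -/
noncomputable def itemOcc (x : X) (Y : List (K × ℕ ⊕ X × Bool)) : ℕ :=
  Y.countP fun z => ∃ b, z = .inr (x, b)

/-- The number of occurrences of variables. -/
def itemVars (Y : List (K × ℕ ⊕ X × Bool)) : ℕ := Y.countP fun z => z.isRight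

/-- The total weight. -/
def itemWeight (Y : List (K × ℕ ⊕ X × Bool)) : ℕ := (Y.map (Sum.elim Prod.snd fun _ => 0)).sum

@[simp] theorem itemOcc_nil (x : X) : itemOcc x ([] : List (K × ℕ ⊕ X × Bool)) = 0 := rfl

@[simp] theorem itemOcc_inl (x : X) (z : K × ℕ) (Y : List (K × ℕ ⊕ X × Bool)) :
    itemOcc x (.inl z :: Y) = itemOcc x Y := by simp [itemOcc]

open Classical in
@[simp] theorem itemOcc_inr (x : X) (z : X × Bool) (Y : List (K × ℕ ⊕ X × Bool)) :
    itemOcc x (.inr z :: Y) = itemOcc x Y + if z.1 = x then 1 else 0 := by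
  obtain ⟨z, b⟩ := z
  cases b <;> simp [itemOcc, List.countP_cons]

@[simp] theorem itemOcc_append (x : X) (Y Z : List (K × ℕ ⊕ X × Bool)) :
    itemOcc x (Y ++ Z) = itemOcc x Y + itemOcc x Z := by simp [itemOcc]

@[simp] theorem itemVars_nil : itemVars ([] : List (K × ℕ ⊕ X × Bool)) = 0 := rfl

@[simp] theorem itemVars_inl (z : K × ℕ) (Y : List (K × ℕ ⊕ X × Bool)) :
    itemVars (.inl z :: Y) = itemVars Y := by simp [itemVars]

@[simp] theorem itemVars_inr (z : X × Bool) (Y : List (K × ℕ ⊕ X × Bool)) :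
    itemVars (.inr z :: Y) = itemVars Y + 1 := List.countP_cons_of_pos rfl

@[simp] theorem itemVars_append (Y Z : List (K × ℕ ⊕ X × Bool)) :
    itemVars (Y ++ Z) = itemVars Y + itemVars Z := by simp [itemVars]

@[simp] theorem itemWeight_nil : itemWeight ([] : List (K × ℕ ⊕ X × Bool)) = 0 := rfl

@[simp] theorem itemWeight_inl (z : K × ℕ) (Y : List (K × ℕ ⊕ X × Bool)) :
    itemWeight (.inl z :: Y) = z.2 + itemWeight Y := by simp [itemWeight]

@[simp] theorem itemWeight_inr (z : X × Bool) (Y : List (K × ℕ ⊕ X × Bool)) :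
    itemWeight (.inr z :: Y) = itemWeight Y := by simp [itemWeight]

@[simp] theorem itemWeight_append (Y Z : List (K × ℕ ⊕ X × Bool)) :
    itemWeight (Y ++ Z) = itemWeight Y + itemWeight Z := by simp [itemWeight]

variable {E L H : Type*} [Group K]

/-- Collecting consecutive constants. -/
def collect (E : Type*) : List (K × ℕ ⊕ X × Bool) → (K × ℕ) × List (List (E ⊕ X × Bool) × K × ℕ)
  | [] => ((1, 0), [])
  | .inl z :: Y => ((z.1 * (collect E Y).1.1, z.2 + (collect E Y).1.2), (collect E Y).2)
  | .inr z :: Y => ((1, 0), ([.inr z], (collect E Y).1) :: (collect E Y).2)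

theorem occ_collect (x : X) (Y : List (K × ℕ ⊕ X × Bool)) :
    occ x (tailWords (collect E Y).2) = itemOcc x Y := by
  induction Y with
  | nil => rfl
  | cons z Y ih =>
    rcases z with z | z
    · simpa [collect] using ih
    · rw [tailWords] at ih
      simp [collect, tailWords, occ_inr, ih]

theorem numVar_collect (Y : List (K × ℕ ⊕ X × Bool)) :
    numVar (tailWords (collect E Y).2) = itemVars Y := by
  induction Y with
  | nil => rfl
  | cons z Y ih =>
    rcases z with z | z
    · simpa [collect] using ih
    · rw [tailWords] at ih
      simp [collect, tailWords, ih]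

theorem length_collect (Y : List (K × ℕ ⊕ X × Bool)) :
    (collect E Y).2.length = itemVars Y := by
  induction Y with
  | nil => rfl
  | cons z Y ih => rcases z with z | z <;> simp [collect, ih]

theorem tailWeight_collect (Y : List (K × ℕ ⊕ X × Bool)) :
    (collect E Y).1.2 + tailWeight (collect E Y).2 = itemWeight Y := by
  induction Y with
  | nil => rfl
  | cons z Y ih =>
    rcases z with z | z
    · simp only [collect, itemWeight_inl]
      omega
    · rw [itemWeight_inr, ← ih]
      simp [collect, tailWeight]

variable [Group E] [Group L] [Group H]

/-- The value of a weighted constant or variable. -/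
def evalItem (lam : L →* H) (κ : K →* H) (f : X → L) : K × ℕ ⊕ X × Bool → H
  | .inl z => κ z.1
  | .inr (x, b) => bif b then lam (f x) else (lam (f x))⁻¹

/-- The value of a list of weighted constants and variables. -/
def evalItems (lam : L →* H) (κ : K →* H) (f : X → L) (Y : List (K × ℕ ⊕ X × Bool)) : H :=
  (Y.map (evalItem lam κ f)).prod

@[simp] theorem evalItems_nil (lam : L →* H) (κ : K →* H) (f : X → L) :
    evalItems lam κ f [] = 1 := rfl

@[simp] theorem evalItems_cons (lam : L →* H) (κ : K →* H) (f : X → L) (z : K × ℕ ⊕ X × Bool)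
    (Y : List (K × ℕ ⊕ X × Bool)) :
    evalItems lam κ f (z :: Y) = evalItem lam κ f z * evalItems lam κ f Y := by simp [evalItems]

@[simp] theorem evalItems_append (lam : L →* H) (κ : K →* H) (f : X → L)
    (Y Z : List (K × ℕ ⊕ X × Bool)) :
    evalItems lam κ f (Y ++ Z) = evalItems lam κ f Y * evalItems lam κ f Z := by simp [evalItems]

/-- The formal inverse. -/
def invItems (Y : List (K × ℕ ⊕ X × Bool)) : List (K × ℕ ⊕ X × Bool) :=
  (Y.map (Sum.map (fun z => (z.1⁻¹, z.2)) fun z => (z.1, !z.2))).reverse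

theorem invItems_cons (z : K × ℕ ⊕ X × Bool) (Y : List (K × ℕ ⊕ X × Bool)) : invItems (z :: Y) =
    invItems Y ++ [Sum.map (fun z => (z.1⁻¹, z.2)) (fun z => (z.1, !z.2)) z] := by
  simp [invItems]

theorem evalItems_invItems (lam : L →* H) (κ : K →* H) (f : X → L)
    (Y : List (K × ℕ ⊕ X × Bool)) :
    evalItems lam κ f (invItems Y) = (evalItems lam κ f Y)⁻¹ := by
  induction Y with
  | nil => simp [invItems]
  | cons z Y ih =>
    rw [invItems_cons, evalItems_append, ih]
    rcases z with z | ⟨x, _ | _⟩ <;> simp [evalItem]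

theorem itemOcc_invItems (x : X) (Y : List (K × ℕ ⊕ X × Bool)) :
    itemOcc x (invItems Y) = itemOcc x Y := by
  induction Y with
  | nil => rfl
  | cons z Y ih =>
    rw [invItems_cons, itemOcc_append, ih]
    rcases z with z | z <;> simp

theorem itemVars_invItems (Y : List (K × ℕ ⊕ X × Bool)) : itemVars (invItems Y) = itemVars Y := by
  induction Y with
  | nil => rfl
  | cons z Y ih =>
    rw [invItems_cons, itemVars_append, ih]
    rcases z with z | z <;> simp

theorem itemWeight_invItems (Y : List (K × ℕ ⊕ X × Bool)) :
    itemWeight (invItems Y) = itemWeight Y := by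
  induction Y with
  | nil => rfl
  | cons z Y ih =>
    rw [invItems_cons, itemWeight_append, ih]
    rcases z with z | z <;> simp [add_comm]

theorem evalItems_eq_collect (lam : L →* H) (κ : K →* H) (ι : E →* L) (f : X → L)
    (Y : List (K × ℕ ⊕ X × Bool)) : evalItems lam κ f Y =
      κ (collect E Y).1.1 * altProd lam κ (evalTail ι f (collect E Y).2) := by
  induction Y with
  | nil => simp [collect]
  | cons z Y ih =>
    rw [evalItems_cons, ih]
    rcases z with z | ⟨x, _ | _⟩ <;> simp [collect, evalItem, evalLetter, mul_assoc]

/-- A list of weighted constants and variables that begins and ends with a constant, has no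
consecutive variables, and has good weights. -/
structure GoodItems (θ : E →* K) (Y : List (K × ℕ ⊕ X × Bool)) : Prop where
  isChain : Y.IsChain fun a b => a.isLeft ∨ b.isLeft
  head : ∀ a ∈ Y.head?, a.isLeft
  last : ∀ a ∈ Y.getLast?, a.isLeft
  good : ∀ z, .inl z ∈ Y → GoodWeight θ z

theorem GoodItems.append {θ : E →* K} {Y Z : List (K × ℕ ⊕ X × Bool)} (hY : GoodItems θ Y)
    (hZ : GoodItems θ Z) : GoodItems θ (Y ++ Z) where
  isChain := List.isChain_append.2 ⟨hY.isChain, hZ.isChain, fun a ha _ _ => Or.inl (hY.last a ha)⟩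
  head a ha := by
    rw [List.head?_append] at ha
    rcases Y with _ | ⟨y, Y⟩
    · exact hZ.head a (by simpa using ha)
    · exact hY.head a (by simpa using ha)
  last a ha := by
    rw [List.getLast?_append] at ha
    rcases h : Z.getLast? with _ | z
    · rw [h] at ha
      exact hY.last a (by simpa using ha)
    · rw [h] at ha
      exact hZ.last a (by simpa [h] using ha)
  good z hz := by
    rcases List.mem_append.1 hz with hz | hz
    · exact hY.good z hz
    · exact hZ.good z hz

theorem GoodItems.singleton {θ : E →* K} (k : K) :
    GoodItems θ ([.inl (k, 2)] : List (K × ℕ ⊕ X × Bool)) where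
  isChain := List.isChain_singleton _
  head a ha := by
    obtain rfl : Sum.inl (k, 2) = a := by simpa using ha
    rfl
  last a ha := by
    obtain rfl : Sum.inl (k, 2) = a := by simpa using ha
    rfl
  good z hz := by
    obtain rfl : z = (k, 2) := by simpa using hz
    exact ⟨by simp, by simp⟩

theorem GoodWeight.inv {θ : E →* K} {z : K × ℕ} (h : GoodWeight θ z) :
    GoodWeight θ (z.1⁻¹, z.2) :=
  ⟨h.1, fun h1 h2 => h.2 h1 (by simpa using inv_mem h2)⟩

theorem GoodItems.invItems {θ : E →* K} {Y : List (K × ℕ ⊕ X × Bool)} (hY : GoodItems θ Y) :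
    GoodItems θ (invItems Y) where
  isChain := by
    rw [QuadEq.invItems, List.isChain_reverse, List.isChain_map]
    refine hY.isChain.imp fun a b h => ?_
    rcases a with a | a <;> rcases b with b | b <;> simp_all
  head a ha := by
    rw [QuadEq.invItems, List.head?_reverse, List.getLast?_map] at ha
    obtain ⟨b, hb, rfl⟩ := Option.mem_map.1 ha
    have := hY.last b hb
    rcases b with b | b <;> simp_all
  last a ha := by
    rw [QuadEq.invItems, List.getLast?_reverse, List.head?_map] at ha
    obtain ⟨b, hb, rfl⟩ := Option.mem_map.1 ha
    have := hY.head b hb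
    rcases b with b | b <;> simp_all
  good z hz := by
    rw [QuadEq.invItems, List.mem_reverse, List.mem_map] at hz
    obtain ⟨b, hb, h⟩ := hz
    rcases b with b | b
    · obtain rfl := Sum.inl.inj h
      exact (hY.good b hb).inv
    · simp at h

/-- Weights are positive, so a run of constants of weight one is a single constant and stays outside
the amalgamated subgroup. Only an empty run has weight zero, and none follows a variable, since
variables are not adjacent and the list does not end in one. -/
theorem good_collect {θ : E →* K} (Y : List (K × ℕ ⊕ X × Bool))
    (hc : Y.IsChain fun a b => a.isLeft ∨ b.isLeft) (hl : ∀ a ∈ Y.getLast?, a.isLeft)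
    (hg : ∀ z, .inl z ∈ Y → GoodWeight θ z) :
    ((collect E Y).1.2 = 0 → (collect E Y).1.1 = 1) ∧
    ((collect E Y).1.2 = 1 → (collect E Y).1.1 ∉ θ.range) ∧
    (∀ a ∈ Y.head?, a.isLeft → 1 ≤ (collect E Y).1.2) ∧
    ∀ x ∈ (collect E Y).2, 0 < numVar x.1 ∧ GoodWeight θ x.2 := by
  induction Y with
  | nil => simp [collect]
  | cons z Y ih =>
    have hc' := List.isChain_cons.1 hc
    obtain ⟨h1, h2, h3, h4⟩ := ih hc'.2 (fun a ha => hl a (by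
      rcases Y with _ | ⟨y, Y⟩
      · simp at ha
      · simpa using ha)) fun z hz => hg z (by simp [hz])
    rcases z with z | z
    · have hz := hg z (by simp)
      have hz1 := hz.1
      refine ⟨fun h => ?_, fun h => ?_, fun a _ _ => ?_, h4⟩
      · simp only [collect] at h
        omega
      · simp only [collect] at h ⊢
        rw [h1 (by omega), mul_one]
        exact hz.2 (by omega)
      · simp only [collect]
        omega
    · refine ⟨fun _ => rfl, fun h => by simp [collect] at h, ?_, ?_⟩
      · intro a ha hleft
        simp only [List.head?_cons, Option.mem_def, Option.some.injEq] at ha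
        subst ha
        simp at hleft
      · intro x hx
        simp only [collect, List.mem_cons] at hx
        rcases hx with rfl | hx
        · refine ⟨by simp, ?_, h2⟩
          rcases Y with _ | ⟨y, Y⟩
          · have := hl (.inr z) (by simp)
            simp at this
          · have := hc'.1 y (by simp)
            exact h3 y (by simp) (by simpa using this)
        · exact h4 x hx

end Items

end QuadEq

namespace QuadEq

/-! ### Expanding an equation by normal forms of the values of its variables. -/

section Blocks

variable {E K L H : Type*} {V : Type v}

/-- The alternating expansion of the value of a variable. -/
def block (k : K) (x : V) (D : List (ℕ × K × ℕ)) : List (K × ℕ ⊕ (V × ℕ) × Bool) :=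
  .inl (k, 2) :: D.flatMap fun d => [.inr ((x, d.1), true), .inl d.2]

open Classical in
theorem itemOcc_block (k : K) (x x' : V) (i : ℕ) (D : List (ℕ × K × ℕ)) :
    itemOcc (x, i) (block k x' D) = if x' = x then (D.map Prod.fst).count i else 0 := by
  rw [block, itemOcc_inl]
  induction D with
  | nil => simp
  | cons d D ih =>
    rw [List.flatMap_cons, itemOcc_append, ih]
    by_cases hx : x' = x <;> simp [hx, List.count_cons, add_comm]

theorem itemVars_block (k : K) (x : V) (D : List (ℕ × K × ℕ)) :
    itemVars (block k x D) = D.length := by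
  rw [block, itemVars_inl]
  induction D with
  | nil => simp
  | cons d D ih => simp [ih]

theorem itemWeight_block (k : K) (x : V) (D : List (ℕ × K × ℕ)) :
    itemWeight (block k x D) = 2 + (D.map fun d => d.2.2).sum := by
  rw [block, itemWeight_inl]
  congr 1
  induction D with
  | nil => simp
  | cons d D ih => simp [ih]

variable [Group E] [Group K] [Group L] [Group H]

theorem goodItems_block {θ : E →* K} (k : K) (x : V) (D : List (ℕ × K × ℕ))
    (hD : ∀ d ∈ D, GoodWeight θ d.2) : GoodItems θ (block k x D) := by
  have key : ∀ z : K × ℕ, GoodWeight θ z → GoodItems θ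
      ((.inl z :: D.flatMap fun d => [.inr ((x, d.1), true), .inl d.2]) :
        List (K × ℕ ⊕ (V × ℕ) × Bool)) := by
    induction D with
    | nil =>
      intro z hz
      refine ⟨List.isChain_singleton _, by simp, by simp, ?_⟩
      intro z' hz'
      obtain rfl : z' = z := by simpa using hz'
      exact hz
    | cons d D ih =>
      intro z hz
      have h := ih (fun d hd => hD d (by simp [hd])) d.2 (hD d (by simp))
      rw [List.flatMap_cons]
      refine ⟨?_, by simp, ?_, ?_⟩
      · refine List.isChain_cons_cons.2 ⟨by simp, List.isChain_cons.2 ⟨by simp, h.isChain⟩⟩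
      · intro a ha
        refine h.last a ?_
        simpa [List.getLast?_cons_cons] using ha
      · intro z' hz'
        simp only [List.cons_append, List.nil_append, List.mem_cons] at hz'
        rcases hz' with hz' | hz' | hz'
        · rw [Sum.inl.inj hz']
          exact hz
        · simp at hz'
        · exact h.good z' (List.mem_cons.2 hz')
  exact key (k, 2) ⟨by simp, by simp⟩

theorem evalItems_block (lam : L →* H) (κ : K →* H) (g : V × ℕ → L) (k : K) (x : V)
    (D : List (ℕ × K × ℕ)) : evalItems lam κ g (block k x D) =
      κ k * altProd lam κ (D.map fun d => (g (x, d.1), d.2.1)) := by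
  rw [block, evalItems_cons]
  congr 1
  induction D with
  | nil => simp
  | cons d D ih => simp [ih, evalItem, mul_assoc]

/-- Tagging the letters of a reduced alternating list. -/
theorem exists_tags {θ : E →* K} {ι : E →* L} (t : List (L × K)) (hl : ∀ x ∈ t, x.1 ∉ ι.range)
    (hk : ∀ x ∈ t.dropLast, x.2 ∉ θ.range) : ∃ (D : List (ℕ × K × ℕ)) (g : ℕ → L),
    t = D.map (fun d => (g d.1, d.2.1)) ∧ (∀ d ∈ D, g d.1 ∉ ι.range) ∧
    (∀ d ∈ D, GoodWeight θ d.2) ∧ (D.map Prod.fst).Nodup ∧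
    (D.map fun d => d.2.2).sum ≤ D.length + 1 := by
  induction t with
  | nil => exact ⟨[], fun _ => 1, by simp⟩
  | cons x t ih =>
    obtain ⟨l, k⟩ := x
    rcases t with _ | ⟨z, t⟩
    -- The last constant of a normal form may lie in the amalgamated subgroup, so it gets weight
    -- two; all others get weight one.
    · exact ⟨[(0, k, 2)], fun _ => l, by simp, by simpa using hl, by simp [GoodWeight], by simp,
        by simp⟩
    · obtain ⟨D, g, h1, h2, h3, h4, h5⟩ := ih (fun x hx => hl x (by simp [hx]))
        fun x hx => hk x (by simp [hx])
      refine ⟨(0, k, 1) :: D.map fun d => (d.1 + 1, d.2), fun n => n.casesOn l g, ?_, ?_, ?_, ?_, ?_⟩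
      · rw [h1]
        simp [Function.comp_def]
      · intro d hd
        simp only [List.mem_cons, List.mem_map] at hd
        rcases hd with rfl | ⟨d, hd, rfl⟩
        · exact hl (l, k) (by simp)
        · exact h2 d hd
      · intro d hd
        simp only [List.mem_cons, List.mem_map] at hd
        rcases hd with rfl | ⟨d, hd, rfl⟩
        · exact ⟨le_rfl, fun _ => hk (l, k) (by simp)⟩
        · exact h3 d hd
      · rw [List.map_cons, List.map_map, List.nodup_cons]
        refine ⟨by simp, ?_⟩
        have : (Prod.fst ∘ fun d : ℕ × K × ℕ => (d.1 + 1, d.2)) = Nat.succ ∘ Prod.fst := rfl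
        rw [this, ← List.map_map]
        exact h4.map Nat.succ_injective
      · simp only [List.map_cons, List.map_map, List.sum_cons, List.length_cons, List.length_map]
        have : ((fun d : ℕ × K × ℕ => d.2.2) ∘ fun d : ℕ × K × ℕ => (d.1 + 1, d.2)) =
          fun d => d.2.2 := rfl
        rw [this]
        omega

/-- The value of an equation whose constants are separated by the variables. -/
def evalEq (κ : K →* H) (f : V → H) (k : K) (W : List ((V × Bool) × K)) : H :=
  κ k * (W.map fun z => (bif z.1.2 then f z.1.1 else (f z.1.1)⁻¹) * κ z.2).prod

open Classical in
/-- The number of occurrences of a variable in an equation. -/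
noncomputable def eqOcc (x : V) (W : List ((V × Bool) × K)) : ℕ := W.countP fun z => z.1.1 = x

/-- The expansion of an equation. -/
def expand (k₀ : V → K) (D : V → List (ℕ × K × ℕ)) (W : List ((V × Bool) × K)) :
    List (K × ℕ ⊕ (V × ℕ) × Bool) :=
  W.flatMap fun z => (bif z.1.2 then block (k₀ z.1.1) z.1.1 (D z.1.1) else
    invItems (block (k₀ z.1.1) z.1.1 (D z.1.1))) ++ [.inl (z.2, 2)]

theorem goodItems_expand {θ : E →* K} (k₀ : V → K) (D : V → List (ℕ × K × ℕ))
    (hD : ∀ x, ∀ d ∈ D x, GoodWeight θ d.2) (k : K) (W : List ((V × Bool) × K)) :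
    GoodItems θ (.inl (k, 2) :: expand k₀ D W) := by
  refine (GoodItems.singleton k).append (?_ : GoodItems θ (expand k₀ D W))
  induction W with
  | nil => exact ⟨List.isChain_nil, by simp [expand], by simp [expand], by simp [expand]⟩
  | cons z W ih =>
    rw [expand, List.flatMap_cons]
    refine (GoodItems.append ?_ (GoodItems.singleton _)).append ih
    have := goodItems_block (k₀ z.1.1) z.1.1 _ (hD z.1.1)
    obtain ⟨⟨x, _ | _⟩, _⟩ := z
    · exact this.invItems
    · exact this

theorem evalItems_expand (lam : L →* H) (κ : K →* H) (g : V × ℕ → L) (k₀ : V → K)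
    (D : V → List (ℕ × K × ℕ)) (k : K) (W : List ((V × Bool) × K)) :
    evalItems lam κ g (.inl (k, 2) :: expand k₀ D W) =
      evalEq κ (fun x => evalItems lam κ g (block (k₀ x) x (D x))) k W := by
  rw [evalItems_cons, evalEq]
  congr 1
  induction W with
  | nil => rfl
  | cons z W ih =>
    rw [expand, List.flatMap_cons, evalItems_append, List.map_cons, List.prod_cons, ← ih]
    congr 1
    obtain ⟨⟨x, _ | _⟩, _⟩ := z <;> simp [evalItems_invItems, evalItem]

theorem itemOcc_expand (k₀ : V → K) (D : V → List (ℕ × K × ℕ)) (x : V) (i : ℕ) (k : K)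
    (W : List ((V × Bool) × K)) : itemOcc (x, i) (.inl (k, 2) :: expand k₀ D W) =
      eqOcc x W * ((D x).map Prod.fst).count i := by
  classical
  rw [itemOcc_inl]
  induction W with
  | nil => simp [expand, eqOcc]
  | cons z W ih =>
    rw [expand, List.flatMap_cons, itemOcc_append]
    rw [expand] at ih
    rw [ih]
    have : itemOcc (x, i) ((bif z.1.2 then block (k₀ z.1.1) z.1.1 (D z.1.1) else
        invItems (block (k₀ z.1.1) z.1.1 (D z.1.1))) ++ [.inl (z.2, 2)]) =
        if z.1.1 = x then ((D x).map Prod.fst).count i else 0 := by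
      obtain ⟨⟨x', _ | _⟩, _⟩ := z <;> simp only [cond_true, cond_false, itemOcc_append,
        itemOcc_invItems, itemOcc_block, itemOcc_inl, itemOcc_nil, add_zero] <;>
        split_ifs with h <;> simp [h]
    rw [this, eqOcc, eqOcc, List.countP_cons]
    by_cases hx : z.1.1 = x <;> simp [hx, add_mul, add_comm]

/-- Each letter of the equation has an excess of 5: two for the first constant of its block, one for
the last, and two for the coefficient after it. The leading coefficient adds 2. -/
theorem itemWeight_expand (k₀ : V → K) (D : V → List (ℕ × K × ℕ))
    (hD : ∀ x, ((D x).map fun d => d.2.2).sum ≤ (D x).length + 1) (k : K)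
    (W : List ((V × Bool) × K)) : itemWeight (.inl (k, 2) :: expand k₀ D W) ≤
      itemVars (.inl (k, 2) :: expand k₀ D W) + 5 * W.length + 2 := by
  rw [itemWeight_inl, itemVars_inl]
  induction W with
  | nil => simp [expand]
  | cons z W ih =>
    rw [expand, List.flatMap_cons, itemWeight_append, itemVars_append]
    rw [expand] at ih
    have : itemWeight ((bif z.1.2 then block (k₀ z.1.1) z.1.1 (D z.1.1) else
        invItems (block (k₀ z.1.1) z.1.1 (D z.1.1))) ++ [.inl (z.2, 2)]) ≤
        itemVars ((bif z.1.2 then block (k₀ z.1.1) z.1.1 (D z.1.1) else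
        invItems (block (k₀ z.1.1) z.1.1 (D z.1.1))) ++ [.inl (z.2, 2)]) + 5 := by
      have := hD z.1.1
      obtain ⟨⟨x, _ | _⟩, _⟩ := z <;> simp only [cond_true, cond_false, itemWeight_append,
        itemVars_append, itemWeight_invItems, itemVars_invItems, itemWeight_block, itemVars_block,
        itemWeight_inl, itemVars_inl, itemWeight_nil, itemVars_nil] at this ⊢ <;> omega
    simp only [List.length_cons]
    omega

/-- A quadratic equation over `K` that is soluble in an amalgamated product of `K` and `L` over an
equationally closed subgroup of `L` is soluble in `K`. -/
theorem IsAmalgam.exists_solution {θ : E →* K} {ι : E →* L} {κ : K →* H} {lam : L →* H}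
    (hA : IsAmalgam θ ι κ lam) {B : ℕ} (hι : EquationallyClosed (V × ℕ) ι (2 * B + 2))
    (k : K) (W : List ((V × Bool) × K)) (hB : 5 * W.length + 2 ≤ 2 * B)
    (hW : ∀ x, eqOcc x W = 0 ∨ eqOcc x W = 2) (f : V → H) (h1 : evalEq κ f k W = 1) :
    ∃ f' : V → K, evalEq (MonoidHom.id K) f' k W = 1 := by
  have hrep : ∀ x, ∃ (k₀ : K) (D : List (ℕ × K × ℕ)) (g : ℕ → L),
      f x = κ k₀ * altProd lam κ (D.map fun d => (g d.1, d.2.1)) ∧ (∀ d ∈ D, g d.1 ∉ ι.range) ∧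
      (∀ d ∈ D, GoodWeight θ d.2) ∧ (D.map Prod.fst).Nodup ∧
      (D.map fun d => d.2.2).sum ≤ D.length + 1 := by
    intro x
    obtain ⟨k₀, t, h, hl, hk⟩ := hA.exists_reduced (f x)
    obtain ⟨D, g, rfl, h'⟩ := exists_tags t hl hk
    exact ⟨k₀, D, g, h, h'⟩
  choose k₀ D g hf hg hgood hnodup hsum using hrep
  -- The `i`-th syllable of the value of `x` becomes the variable `(x, i)`, used in every occurrence
  -- of `x^{±1}`. Tags within a block are distinct, so each new variable occurs twice or not at all.
  let g' : V × ℕ → L := fun z => g z.1 z.2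
  let Y : List (K × ℕ ⊕ (V × ℕ) × Bool) := .inl (k, 2) :: expand k₀ D W
  have hY : GoodItems θ Y := goodItems_expand k₀ D hgood k W
  have hYval : evalItems lam κ g' Y = 1 := by
    rw [evalItems_expand, ← h1]
    congr 1
    funext x
    rw [evalItems_block, hf x]
  have hcol := good_collect Y hY.isChain hY.last hY.good
  rw [evalItems_eq_collect lam κ ι] at hYval
  obtain ⟨sys, s1, s2, s3, s4, s5, s6⟩ := hA.exists_split g' _ (collect E Y).1.1 (collect E Y).2 rfl
    (fun x hx => (hcol.2.2.2 x hx).1) (fun x hx => (hcol.2.2.2 x hx).2) hYval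
  have hocc : ∀ x i, occ (x, i) sys.flatten = eqOcc x W * ((D x).map Prod.fst).count i := by
    intro x i
    rw [s3, occ_collect, itemOcc_expand]
  -- Combined with `s5`, where `2 * itemVars Y` is at most twice the number of words plus the
  -- weight, this bounds `itemVars Y` by `2 * sys.length + 2 * B`.
  have hwt : tailWeight (collect E Y).2 ≤ itemVars Y + 5 * W.length + 2 := by
    have := tailWeight_collect (E := E) Y
    have : itemWeight Y ≤ itemVars Y + 5 * W.length + 2 := itemWeight_expand k₀ D hsum k W
    omega
  rw [length_collect] at s5
  rw [numVar_collect] at s4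
  obtain ⟨f', hf'⟩ := exists_solution_of_system hι sys.length sys g' rfl s2 s1 (by
      rintro ⟨x, i⟩
      rw [hocc]
      have := List.nodup_iff_count_le_one.1 (hnodup x) i
      rcases hW x with h | h <;> rw [h] <;> omega) (by
      rintro ⟨x, i⟩ hx
      rw [hocc] at hx
      have hpos : 0 < ((D x).map Prod.fst).count i := Nat.pos_of_ne_zero (right_ne_zero_of_mul hx)
      obtain ⟨d, hd, rfl⟩ := List.mem_map.1 (List.count_pos_iff.1 hpos)
      exact hg x d hd) (by omega)
  have h6 := s6 f' hf'
  have h7 := evalItems_eq_collect θ (MonoidHom.id K) (MonoidHom.id E) f' Y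
  rw [MonoidHom.id_apply, h6, evalItems_expand] at h7
  exact ⟨_, h7⟩

end Blocks

end QuadEq

namespace QuadEq

/-! ### The embedding into a group with two generators -/

/-! ### Translating words into equations with separated constants. -/

section Solutions

variable {A : Type v} {X : Type w} {G Γ Δ : Type*} [Group G] [Group Γ] [Group Δ]

theorem hasSolution_iff (a : A → Γ) (W : Word A X) : HasSolution (toFreeProduct a W) ↔
    ∃ f : X → Γ, FreeGroup.lift (Sum.elim a f) (FreeGroup.mk W) = 1 := by
  have key : ∀ ψ : Monoid.Coprod Γ (FreeGroup X) →* Γ,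
      ψ.comp Monoid.Coprod.inl = MonoidHom.id Γ → ψ (toFreeProduct a W) =
        FreeGroup.lift (Sum.elim a fun x => ψ (Monoid.Coprod.inr (FreeGroup.of x)))
          (FreeGroup.mk W) := by
    intro ψ hψ
    rw [toFreeProduct, ← MonoidHom.comp_apply]
    congr 1
    ext (i | x)
    · simpa using DFunLike.congr_fun hψ (a i)
    · simp
  constructor
  · rintro ⟨ψ, hψ, h⟩
    exact ⟨_, (key ψ hψ).symm.trans h⟩
  · rintro ⟨f, hf⟩
    refine ⟨Monoid.Coprod.lift (MonoidHom.id Γ) (FreeGroup.lift f), by ext; simp, ?_⟩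
    rw [key _ (by ext; simp)]
    simpa using hf

/-- Collecting the constants of a word. -/
def compress (a : A → G) : Word A X → G × List ((X × Bool) × G)
  | [] => (1, [])
  | (.inl i, b) :: W => ((bif b then a i else (a i)⁻¹) * (compress a W).1, (compress a W).2)
  | (.inr x, b) :: W => (1, ((x, b), (compress a W).1) :: (compress a W).2)

theorem lift_eq_evalEq (a : A → G) (κ : G →* Γ) (f : X → Γ) (W : Word A X) :
    FreeGroup.lift (Sum.elim (fun i => κ (a i)) f) (FreeGroup.mk W) =
      evalEq κ f (compress a W).1 (compress a W).2 := by
  induction W with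
  | nil => simp [compress, evalEq, FreeGroup.one_eq_mk.symm]
  | cons z W ih =>
    obtain ⟨i | x, b⟩ := z <;> rw [TwoFree.mk_cons, map_mul, ih] <;> cases b <;>
      simp [compress, evalEq, mul_assoc]

theorem length_compress (a : A → G) (W : Word A X) : (compress a W).2.length = xLength W := by
  induction W with
  | nil => rfl
  | cons z W ih =>
    rw [xLength] at ih
    obtain ⟨i | x, b⟩ := z <;> simp [compress, xLength, ih, List.countP_cons]

theorem eqOcc_compress (a : A → G) (x : X) (W : Word A X) :
    eqOcc x (compress a W).2 = occurrences x W := by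
  classical
  induction W with
  | nil => rfl
  | cons z W ih =>
    rw [occurrences, eqOcc] at ih
    obtain ⟨i | y, b⟩ := z
    · simp [compress, occurrences, eqOcc, ih]
    · by_cases h : y = x <;> cases b <;>
        simp [compress, occurrences, eqOcc, ih, h] <;> omega

theorem map_evalEq (κ : G →* Γ) (φ : Γ →* Δ) (f : X → Γ) (k : G) (W : List ((X × Bool) × G)) :
    φ (evalEq κ f k W) = evalEq (φ.comp κ) (fun x => φ (f x)) k W := by
  rw [evalEq, evalEq, map_mul, map_list_prod, List.map_map]
  congr 3
  funext z
  obtain ⟨⟨x, _ | _⟩, g⟩ := z <;> simp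

theorem evalEq_comp (j : G →* Γ) (κ : Γ →* Δ) (f : X → Δ) (k : G) (W : List ((X × Bool) × G)) :
    evalEq (κ.comp j) f k W = evalEq κ f (j k) (W.map fun z => (z.1, j z.2)) := by
  rw [evalEq, evalEq, List.map_map]
  rfl

end Solutions

/-! ### The factor containing `G` and its free subgroup. -/

section Host

/-- A square root of the translation by the distinguished basis element on one of two sheets. -/
def root : Equiv.Perm (BaseFree × Bool) where
  toFun z := match z with
    | (x, true) => (x, false)
    | (x, false) => (TwoFree.c * x, true)
  invFun z := match z with
    | (x, true) => (TwoFree.c⁻¹ * x, false)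
    | (x, false) => (x, true)
  left_inv := by rintro ⟨x, _ | _⟩ <;> simp
  right_inv := by rintro ⟨x, _ | _⟩ <;> simp

/-- Translation by two different basis elements on the two sheets. -/
def translation (i : ℕ) : Equiv.Perm (BaseFree × Bool) where
  toFun z := match z with
    | (x, true) => (TwoFree.y (2 * i) * x, true)
    | (x, false) => (TwoFree.y (2 * i + 1) * x, false)
  invFun z := match z with
    | (x, true) => ((TwoFree.y (2 * i))⁻¹ * x, true)
    | (x, false) => ((TwoFree.y (2 * i + 1))⁻¹ * x, false)
  left_inv := by rintro ⟨x, _ | _⟩ <;> simp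
  right_inv := by rintro ⟨x, _ | _⟩ <;> simp

variable {G : Type u} [Group G]

/-- The images of the basis elements of the amalgamated subgroup. -/
def hostGen (γ : ℕ → G) : Option ℕ → G × Equiv.Perm (BaseFree × Bool)
  | none => (1, root ^ 2)
  | some j => if j % 2 = 0 then (1, translation (j / 2)) else
      (γ (j / 2), root⁻¹ * translation (j / 2) * root)

/-- The embedding of the amalgamated subgroup. -/
def hostHom (γ : ℕ → G) : BaseFree →* G × Equiv.Perm (BaseFree × Bool) :=
  FreeGroup.lift (hostGen γ)

/-- On the sheet `true` every generator acts as a left translation: `root ^ 2` by `c`, `translation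
i` by `y (2 * i)`, and its conjugate by `root`, which passes through the other sheet, by `y (2 * i +
1)`. The regular action makes `hostHom` injective whatever the component in `G`. -/
theorem hostGen_apply (γ : ℕ → G) (o : Option ℕ) (x : BaseFree) :
    (hostGen γ o).2 (x, true) = (FreeGroup.of o * x, true) := by
  rcases o with _ | j
  · rfl
  · rw [hostGen]
    split_ifs with h
    · have h2 : 2 * (j / 2) = j := by omega
      change (TwoFree.y (2 * (j / 2)) * x, true) = _
      rw [h2]
      rfl
    · have h2 : 2 * (j / 2) + 1 = j := by omega
      change (TwoFree.y (2 * (j / 2) + 1) * x, true) = _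
      rw [h2]
      rfl

theorem hostHom_apply (γ : ℕ → G) (e : BaseFree) : ∀ x : BaseFree,
    (hostHom γ e).2 (x, true) = (e * x, true) := by
  induction e using FreeGroup.induction_on with
  | C1 => simp
  | of o => intro x; simpa [hostHom] using hostGen_apply γ o x
  | inv_of o ih =>
    intro x
    rw [map_inv, Prod.snd_inv, Equiv.Perm.inv_eq_iff_eq, ih]
    simp
  | mul a b ha hb =>
    intro x
    rw [map_mul, Prod.snd_mul, Equiv.Perm.mul_apply, hb, ha, mul_assoc]

theorem hostHom_injective (γ : ℕ → G) : Function.Injective (hostHom γ) := by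
  intro e e' h
  have h1 := hostHom_apply γ e 1
  rw [h, hostHom_apply] at h1
  simpa using h1.symm

end Host

/-- Every countable group embeds into a group with two generators such that solubility of quadratic
equations of bounded length is preserved. -/
theorem exists_embedding (n : ℕ) (G : Type u) [Group G] [Countable G] :
    ∃ (H : Type u) (_ : Group H) (h₁ h₂ : H) (μ : G →* H),
      Subgroup.closure {h₁, h₂} = ⊤ ∧ Function.Injective μ ∧
      ∀ (X : Type w) (k : G) (W : List ((X × Bool) × G)), (∀ x, eqOcc x W = 0 ∨ eqOcc x W = 2) →
        W.length ≤ n → ∀ f : X → H, evalEq μ f k W = 1 →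
          ∃ f' : X → G, evalEq (MonoidHom.id G) f' k W = 1 := by
  obtain ⟨γ, hγ⟩ := exists_surjective_nat G
  -- This gives `5 * n + 2 ≤ 2 * B`; `N` is then the value for which the embedding is equationally
  -- closed up to `2 * B + 2`.
  let B := 3 * n + 1
  let N := 30 * (2 * B + 2) + 1
  -- Both factors of the amalgam must live in the universe of `G`.
  let e : TwoFree ≃* ULift.{u} TwoFree := MulEquiv.ulift.symm
  let ι : BaseFree →* ULift.{u} TwoFree := e.toMonoidHom.comp (TwoFree.embed N)
  let θ := hostHom γ
  have hι : Function.Injective ι := e.injective.comp (embed_injective N (by omega))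
  have hA := isAmalgam_pushout θ ι (hostHom_injective γ) hι
  let s : Amalgam θ ι := Amalgam.inl θ ι (1, root)
  let d : Amalgam θ ι := Amalgam.inr θ ι (e (HNNExtension.of (Multiplicative.ofAdd 1)))
  let C : Subgroup (Amalgam θ ι) := Subgroup.closure {s, d}
  have hs : s ∈ C := Subgroup.subset_closure (by simp)
  have hd : d ∈ C := Subgroup.subset_closure (by simp)
  have hgen : ∀ o, Amalgam.inl θ ι (hostGen γ o) ∈ C := by
    have hc : Amalgam.inl θ ι (hostGen γ none) ∈ C := by
      have : hostGen γ none = (1, root) ^ 2 := by simp [hostGen]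
      rw [this, map_pow]
      exact pow_mem hs 2
    have hlift : ∀ o, Amalgam.inl θ ι (hostGen γ o) = Amalgam.inr θ ι (ι (FreeGroup.of o)) := by
      intro o
      rw [← hA.comm]
      simp [θ, hostHom]
    rintro (_ | j)
    · exact hc
    · rw [hlift]
      -- Since `s ^ 2` is the image of `c`, which is the stable letter, `C` contains the subgroup
      -- generated by the stable letter and the cyclic factor, hence every long word.
      have hle : Subgroup.closure {TwoFree.embed N (FreeGroup.of none),
          HNNExtension.of (Multiplicative.ofAdd 1)} ≤
          C.comap ((Amalgam.inr θ ι).comp e.toMonoidHom) := by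
        rw [Subgroup.closure_le]
        rintro z (rfl | rfl)
        · rw [hlift] at hc
          exact hc
        · exact hd
      refine hle (?_ : TwoFree.embed N (FreeGroup.of (some j)) ∈ _)
      have : TwoFree.embed N (FreeGroup.of (some j)) = TwoFree.longWord j (N + 2) := by
        simp [TwoFree.embed]
      rw [this]
      exact TwoFree.longWord_mem N j _
  let j : G →* G × Equiv.Perm (BaseFree × Bool) := MonoidHom.inl _ _
  have hG : ∀ g, Amalgam.inl θ ι (j g) ∈ C := by
    intro g
    obtain ⟨i, rfl⟩ := hγ g
    have h0 := hgen (some (2 * i))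
    have h1 := hgen (some (2 * i + 1))
    have e0 : hostGen γ (some (2 * i)) = (1, translation i) := by simp [hostGen]
    have e1 : hostGen γ (some (2 * i + 1)) = (γ i, root⁻¹ * translation i * root) := by
      have h2 : (2 * i + 1) / 2 = i := by omega
      have h3 : (2 * i + 1) % 2 = 1 := by omega
      simp [hostGen, h2, h3]
    -- The two basis elements of index `i` differ, after conjugation by `root`, exactly by the
    -- element `γ i` of `G`.
    have : j (γ i) = hostGen γ (some (2 * i + 1)) *
        ((1, root)⁻¹ * hostGen γ (some (2 * i)) * (1, root))⁻¹ := by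
      rw [e0, e1]
      simp [j]
    rw [this, map_mul, map_inv, map_mul, map_mul, map_inv]
    exact mul_mem h1 (inv_mem (mul_mem (mul_mem (inv_mem hs) h0) hs))
  let μ : G →* C := ((Amalgam.inl θ ι).comp j).codRestrict C hG
  refine ⟨C, inferInstance, ⟨s, hs⟩, ⟨d, hd⟩, μ, ?_, ?_, ?_⟩
  · rw [← Subgroup.closure_closure_coe_preimage (k := {s, d})]
    congr 1
    ext z
    simp [Subtype.ext_iff]
  · intro g g' h
    have : Amalgam.inl θ ι (j g) = Amalgam.inl θ ι (j g') := congrArg Subtype.val h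
    exact congrArg Prod.fst (hA.injective this)
  · intro X k W hW hn f hf
    have h1 := congrArg C.subtype hf
    rw [map_evalEq, map_one] at h1
    have h2 : C.subtype.comp μ = (Amalgam.inl θ ι).comp j := rfl
    rw [h2, evalEq_comp] at h1
    have hcl : EquationallyClosed (X × ℕ) ι (2 * B + 2) := by
      intro S g hS hg
      refine equationallyClosed_embed (2 * B + 2) S (fun x => e.symm (g x)) hS ?_
      have := congrArg e.symm.toMonoidHom hg
      rw [← evalWord_comp, map_one] at this
      exact this
    obtain ⟨f', hf'⟩ := hA.exists_solution hcl (j k) (W.map fun z => (z.1, j z.2))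
      (by rw [List.length_map]; omega) (by
        intro x
        have : eqOcc x (W.map fun z => (z.1, j z.2)) = eqOcc x W := by
          simp [eqOcc, List.countP_map, Function.comp_def]
        rw [this]
        exact hW x) _ h1
    rw [← evalEq_comp] at hf'
    -- The coefficients lie in the direct factor `G`, so projecting the solution keeps the equation.
    have h3 := congrArg (MonoidHom.fst G _) hf'
    rw [map_evalEq, map_one] at h3
    exact ⟨_, h3⟩

end QuadEq

theorem theorem1 (n : ℕ) (hn : 2 ≤ n) (G : Type u) [Group G] [Countable G] :
    ∃ (H : Type u) (_ : Group H) (h₁ h₂ : H) (μ : G →* H),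
      Subgroup.closure {h₁, h₂} = ⊤ ∧ Function.Injective μ ∧
      ∀ (A : Type v) (X : Type w) [Countable A] [Countable X]
        (a : A → G) (_ : Subgroup.closure (Set.range a) = ⊤)
        (W : QuadEq.Word A X), QuadEq.IsQuadraticEquation W → QuadEq.xLength W ≤ n →
          (QuadEq.HasSolution (QuadEq.toFreeProduct a W) ↔
            QuadEq.HasSolution (QuadEq.toFreeProduct (fun i => μ (a i)) W)) := by
  obtain ⟨H, hH, h₁, h₂, μ, hgen, hinj, h⟩ := QuadEq.exists_embedding.{u, w} n G
  refine ⟨H, hH, h₁, h₂, μ, hgen, hinj, ?_⟩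
  intro A X _ _ a _ W hW hlen
  have hG : ∀ f : X → G, FreeGroup.lift (Sum.elim a f) (FreeGroup.mk W) =
      QuadEq.evalEq (MonoidHom.id G) f (QuadEq.compress a W).1 (QuadEq.compress a W).2 :=
    fun f => QuadEq.lift_eq_evalEq a (MonoidHom.id G) f W
  simp only [QuadEq.hasSolution_iff, hG, QuadEq.lift_eq_evalEq a μ]
  constructor
  · rintro ⟨f, hf⟩
    refine ⟨fun x => μ (f x), ?_⟩
    have := congrArg μ hf
    rw [QuadEq.map_evalEq, map_one] at this
    exact this
  · rintro ⟨f, hf⟩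
    refine h X _ _ (fun x => ?_) ((QuadEq.length_compress a W).trans_le hlen) f hf
    rw [QuadEq.eqOcc_compress]
    exact (hW.occurrences_eq x).symm
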